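/- Let $M$ be a smooth real manifold (respectively a complex manifold) of finite dimension with a smooth (respectively holomorphic) Poisson tensor $\pi$, i.e. a smooth section of $\wedge^2 TM$ (respectively a holomorphic section of $\wedge^2\Theta_M$, where $\Theta_M$ is the holomorphic tangent bundle; below, $TM$ stands for $\Theta_M$ and sections are holomorphic in the complex case) with $\{\pi,\pi\}=0$ for the Schouten bracket. Let $\underline{Der}$ be the sheaf of Poisson vector fields, i.e. vector fields $v$ with $\{v,\pi\}=0$, and let $\underline{Ham}\subset\underline{Der}$ be the subsheaf of locally hamiltonian vector fields, i.e. those which are locally of the form $X_f=i(df)\pi$ with $f$ a smooth (respectively holomorphic) function. A Koszul operator over an open set $U\subseteq M$ is a linear operator $D:\wedge^pTM\to\wedge^{p-1}TM$ ($p\ge 0$) on the sheaf of multivector fields over $U$ which generates the Schouten bracket: $$\{u,v\}=(-1)^p\bigl[D(u\wedge v)-(Du)\wedge v-(-1)^p\,u\wedge (Dv)\bigr],\qquad u\in\wedge^pTM,\ v\in\wedge^qTM.$$ Then every point of $M$ has an open neighbourhood over which there is a Koszul operator of square $0$; for every open $U\subseteq M$ and every Koszul operator $D$ of square $0$ over $U$,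 the vector field $D\pi$ on $U$ is Poisson; and there is a unique global section $\xi$ of the quotient sheaf $\underline{Der}/\underline{Ham}$ (the canonical outer vector field) such that, for every open $U\subseteq M$ and every Koszul operator $D$ of square $0$ over $U$, the restriction $\xi|_U$ is the class of $D\pi$. -/

import Mathlib

open scoped ContDiff Manifold Topology
open TopologicalSpace

set_option linter.unusedSectionVars false

noncomputable section

universe u

namespace PoissonGeometry

/-! ### Multivector fields on open subsets of a vector space, in linear coordinates -/

section Flat

variable (𝕜 : Type) [RCLike 𝕜] (E : Type) [NormedAddCommGroup E] [NormedSpace 𝕜 E]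
  [FiniteDimensional 𝕜 E]

/-- A basis `e_1, …, e_n` of the model space; `∂_i` is the derivative along `e_i`. -/
def frame : Module.Basis (Fin (Module.finrank 𝕜 E)) 𝕜 E :=
  Module.finBasis 𝕜 E

/-- The basis `e_I = e_{i₁} ∧ ⋯ ∧ e_{i_p}` of the exterior algebra of the model space. -/
def wedgeFrame :
    Module.Basis (Finset (Fin (Module.finrank 𝕜 E))) 𝕜 (ExteriorAlgebra 𝕜 E) :=
  (frame 𝕜 E).ExteriorAlgebra

variable {𝕜 E}

/-- The interior product `i(α)`: the antiderivation of degree `-1` of the exterior algebra with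
`i(α) X = α(X)`, that is `i(α)(X ∧ w) = α(X) w - X ∧ i(α) w`. -/
def interiorProduct {V : Type} [AddCommGroup V] [Module 𝕜 V] (α : Module.Dual 𝕜 V) :
    ExteriorAlgebra 𝕜 V →ₗ[𝕜] ExteriorAlgebra 𝕜 V :=
  CliffordAlgebra.contractLeft α

/-- The components `u^I` of `u = ∑ u^I e_I`. -/
def component (u : E → ExteriorAlgebra 𝕜 E) (I : Finset (Fin (Module.finrank 𝕜 E))) (y : E) : 𝕜 :=
  (wedgeFrame 𝕜 E).repr (u y) I

/-- The componentwise partial derivative `∂_i u = ∑ (∂_i u^I) e_I`. -/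
def partialDeriv (i : Fin (Module.finrank 𝕜 E)) (u : E → ExteriorAlgebra 𝕜 E) (y : E) :
    ExteriorAlgebra 𝕜 E :=
  ∑ I, fderiv 𝕜 (component u I) y (frame 𝕜 E i) • wedgeFrame 𝕜 E I

/-- The Schouten bracket in linear coordinates: for `u` of degree `p`,
`{u, v} = ∑_i (-1)^(p-1) i(dx^i)u ∧ ∂_i v - ∂_i u ∧ i(dx^i)v`.
The sign `(-1)^(p-1)` is produced by the grade involution. It is the usual Lie bracket on vector
fields, and `{X, f} = X f`. -/
def flatSchouten (u v : E → ExteriorAlgebra 𝕜 E) (y : E) : ExteriorAlgebra 𝕜 E :=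
  ∑ i, (CliffordAlgebra.involute (interiorProduct ((frame 𝕜 E).coord i) (u y)) * partialDeriv i v y
    - partialDeriv i u y * interiorProduct ((frame 𝕜 E).coord i) (v y))

theorem component_congr {u v : E → ExteriorAlgebra 𝕜 E} {y : E} (h : u =ᶠ[𝓝 y] v)
    (I : Finset (Fin (Module.finrank 𝕜 E))) : component u I =ᶠ[𝓝 y] component v I := by
  filter_upwards [h] with z hz
  simp [component, hz]

theorem partialDeriv_congr {u v : E → ExteriorAlgebra 𝕜 E} {y : E} (h : u =ᶠ[𝓝 y] v)
    (i : Fin (Module.finrank 𝕜 E)) : partialDeriv i u y = partialDeriv i v y := by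
  simp only [partialDeriv]
  exact Finset.sum_congr rfl fun I _ => by rw [(component_congr h I).fderiv_eq]

theorem flatSchouten_congr {u u' v v' : E → ExteriorAlgebra 𝕜 E} {y : E} (hu : u =ᶠ[𝓝 y] u')
    (hv : v =ᶠ[𝓝 y] v') : flatSchouten u v y = flatSchouten u' v' y := by
  simp only [flatSchouten, partialDeriv_congr hu, partialDeriv_congr hv, hu.eq_of_nhds,
    hv.eq_of_nhds]

/-- All components are smooth at `y`. -/
def SmoothAt (u : E → ExteriorAlgebra 𝕜 E) (y : E) : Prop :=
  ∀ I, ContDiffAt 𝕜 ∞ (component u I) y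

theorem SmoothAt.congr {u v : E → ExteriorAlgebra 𝕜 E} {y : E} (hu : SmoothAt u y)
    (h : v =ᶠ[𝓝 y] u) : SmoothAt v y :=
  fun I => (hu I).congr_of_eventuallyEq (component_congr h I)

theorem SmoothAt.add {u v : E → ExteriorAlgebra 𝕜 E} {y : E} (hu : SmoothAt u y)
    (hv : SmoothAt v y) : SmoothAt (u + v) y := by
  intro I
  have : component (u + v) I = component u I + component v I := by
    ext z; simp [component]
  rw [this]
  exact (hu I).add (hv I)

theorem smoothAt_const (a : ExteriorAlgebra 𝕜 E) (y : E) : SmoothAt (fun _ => a) y :=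
  fun _ => contDiffAt_const

theorem SmoothAt.mul {u v : E → ExteriorAlgebra 𝕜 E} {y : E} (hu : SmoothAt u y)
    (hv : SmoothAt v y) : SmoothAt (u * v) y := by
  intro I
  have : component (u * v) I = fun z => ∑ J, ∑ K, component u J z * (component v K z *
      (wedgeFrame 𝕜 E).repr (wedgeFrame 𝕜 E J * wedgeFrame 𝕜 E K) I) := by
    ext z
    simp only [component, Pi.mul_apply]
    conv_lhs => rw [← (wedgeFrame 𝕜 E).sum_repr (u z), ← (wedgeFrame 𝕜 E).sum_repr (v z)]
    rw [Finset.sum_mul_sum, map_sum, Finsupp.finsetSum_apply]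
    refine Finset.sum_congr rfl fun J _ => ?_
    rw [map_sum, Finsupp.finsetSum_apply]
    refine Finset.sum_congr rfl fun K _ => ?_
    rw [smul_mul_smul_comm, map_smul, Finsupp.smul_apply, smul_eq_mul, mul_assoc]
  rw [this]
  exact ContDiffAt.sum fun J _ => ContDiffAt.sum fun K _ =>
    (hu J).mul ((hv K).mul contDiffAt_const)

theorem partialDeriv_add {u v : E → ExteriorAlgebra 𝕜 E} {y : E} (hu : SmoothAt u y)
    (hv : SmoothAt v y) (i : Fin (Module.finrank 𝕜 E)) :
    partialDeriv i (u + v) y = partialDeriv i u y + partialDeriv i v y := by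
  simp only [partialDeriv, ← Finset.sum_add_distrib, ← add_smul]
  refine Finset.sum_congr rfl fun I _ => ?_
  have : component (u + v) I = component u I + component v I := by
    ext z; simp [component]
  rw [this, fderiv_add ((hu I).differentiableAt (by simp)) ((hv I).differentiableAt (by simp))]
  rfl

theorem flatSchouten_add_left {u u' : E → ExteriorAlgebra 𝕜 E} (v : E → ExteriorAlgebra 𝕜 E)
    {y : E} (hu : SmoothAt u y) (hu' : SmoothAt u' y) :
    flatSchouten (u + u') v y = flatSchouten u v y + flatSchouten u' v y := by
  simp only [flatSchouten, ← Finset.sum_add_distrib]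
  refine Finset.sum_congr rfl fun i _ => ?_
  rw [partialDeriv_add hu hu', Pi.add_apply, map_add, map_add, add_mul, add_mul]
  abel

end Flat

/-! ### Multivector fields on a manifold -/

section Manifold

variable {𝕜 : Type} [RCLike 𝕜] {E : Type} [NormedAddCommGroup E] [NormedSpace 𝕜 E]
  [FiniteDimensional 𝕜 E] {M : Type u} [TopologicalSpace M] [ChartedSpace E M]

variable (𝕜 E) in
/-- The fibre at `x` of the bundle `⋀ TM = ⨁_p ⋀^p TM`, where `TM` is the tangent bundle
(the holomorphic tangent bundle if `𝕜 = ℂ`). -/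
abbrev Fibre (x : M) : Type := ExteriorAlgebra 𝕜 (TangentSpace 𝓘(𝕜, E) x)

variable (𝕜 E) in
/-- Not necessarily continuous sections of `⋀ TM` over an open set `V`. -/
abbrev RoughField (V : Opens M) : Type u := (x : V) → Fibre 𝕜 E (x : M)

/-- Extension of a section over `V` by zero; only its germs at points of `V` are ever used. -/
def extendZero {V : Opens M} (u : RoughField 𝕜 E V) (x : M) : Fibre 𝕜 E x :=
  open Classical in if h : x ∈ V then u ⟨x, h⟩ else 0

/-- The derivative `T_x M → E` at `x` of the preferred chart at `x₀`. -/
def chartDeriv (x₀ x : M) : TangentSpace 𝓘(𝕜, E) x →L[𝕜] E :=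
  mfderiv 𝓘(𝕜, E) 𝓘(𝕜, E) (extChartAt 𝓘(𝕜, E) x₀) x

theorem extendZero_of_mem {V : Opens M} (u : RoughField 𝕜 E V) {x : M} (h : x ∈ V) :
    extendZero u x = u ⟨x, h⟩ :=
  dif_pos h

theorem extendZero_of_notMem {V : Opens M} (u : RoughField 𝕜 E V) {x : M} (h : x ∉ V) :
    extendZero u x = 0 :=
  dif_neg h

/-- The expression of a section of `⋀ TM` in the preferred chart at `x₀`. -/
def inChart (x₀ : M) {V : Opens M} (u : RoughField 𝕜 E V) (y : E) : ExteriorAlgebra 𝕜 E :=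
  ExteriorAlgebra.map (chartDeriv x₀ ((extChartAt 𝓘(𝕜, E) x₀).symm y)).toLinearMap
    (extendZero u ((extChartAt 𝓘(𝕜, E) x₀).symm y))

/-- The Schouten bracket `{u, v}` of two sections of `⋀ TM` over `V`. -/
def schouten {V : Opens M} (u v : RoughField 𝕜 E V) : RoughField 𝕜 E V := fun x =>
  ExteriorAlgebra.map (chartDeriv (x : M) (x : M)).inverse.toLinearMap
    (flatSchouten (inChart (x : M) u) (inChart (x : M) v) (extChartAt 𝓘(𝕜, E) (x : M) (x : M)))

/-- `u` is a smooth (holomorphic if `𝕜 = ℂ`) section over `V`. -/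
def IsSmoothField {V : Opens M} (u : RoughField 𝕜 E V) : Prop :=
  ∀ x : V, SmoothAt (inChart (x : M) u) (extChartAt 𝓘(𝕜, E) (x : M) (x : M))

/-- Restriction of sections to a smaller open set. -/
def roughRes {U V : Opens M} (h : V ≤ U) (u : RoughField 𝕜 E U) : RoughField 𝕜 E V :=
  fun x => u ⟨x, h x.2⟩

/-- A chart pulls a neighbourhood of `x` back to a neighbourhood of the image of `x`. -/
theorem eventually_symm_mem (x : M) {V : Opens M} (hx : x ∈ V) :
    ∀ᶠ y in 𝓝 (extChartAt 𝓘(𝕜, E) x x), (extChartAt 𝓘(𝕜, E) x).symm y ∈ V := by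
  have h := continuousAt_extChartAt_symm (I := 𝓘(𝕜, E)) x
  refine h.eventually_mem ?_
  rw [extChartAt_to_inv]
  exact V.isOpen.mem_nhds hx

theorem inChart_roughRes {U V : Opens M} (h : V ≤ U) (u : RoughField 𝕜 E U) (x : V) :
    inChart (x : M) (roughRes h u) =ᶠ[𝓝 (extChartAt 𝓘(𝕜, E) (x : M) (x : M))]
      inChart (x : M) u := by
  filter_upwards [eventually_symm_mem (𝕜 := 𝕜) (E := E) (x : M) x.2] with y hy
  rw [inChart, inChart, extendZero_of_mem _ hy, extendZero_of_mem _ (h hy), roughRes]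

theorem schouten_roughRes {U V : Opens M} (h : V ≤ U) (u v : RoughField 𝕜 E U) :
    schouten (roughRes h u) (roughRes h v) = roughRes h (schouten u v) := by
  funext x
  simp only [schouten, roughRes]
  rw [flatSchouten_congr (inChart_roughRes h u x) (inChart_roughRes h v x)]

theorem IsSmoothField.roughRes {U V : Opens M} (h : V ≤ U) {u : RoughField 𝕜 E U}
    (hu : IsSmoothField u) : IsSmoothField (roughRes h u) :=
  fun x => (hu ⟨x, h x.2⟩).congr (inChart_roughRes h u x)

theorem inChart_add (x : M) {V : Opens M} (u v : RoughField 𝕜 E V) :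
    inChart x (u + v) = inChart x u + inChart x v := by
  funext y
  by_cases h : (extChartAt 𝓘(𝕜, E) x).symm y ∈ V
  · rw [Pi.add_apply, inChart, inChart, inChart, extendZero_of_mem _ h, extendZero_of_mem _ h,
      extendZero_of_mem _ h, Pi.add_apply, map_add]
  · rw [Pi.add_apply, inChart, inChart, inChart, extendZero_of_notMem _ h,
      extendZero_of_notMem _ h, extendZero_of_notMem _ h, map_zero, add_zero]

theorem inChart_mul (x : M) {V : Opens M} (u v : RoughField 𝕜 E V) :
    inChart x (u * v) = inChart x u * inChart x v := by
  funext y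
  by_cases h : (extChartAt 𝓘(𝕜, E) x).symm y ∈ V
  · rw [Pi.mul_apply, inChart, inChart, inChart, extendZero_of_mem _ h, extendZero_of_mem _ h,
      extendZero_of_mem _ h, Pi.mul_apply, map_mul]
  · rw [Pi.mul_apply, inChart, inChart, inChart, extendZero_of_notMem _ h,
      extendZero_of_notMem _ h, extendZero_of_notMem _ h, map_zero, mul_zero]

variable (𝕜 E) in
/-- The algebra `Γ(V, ⋀ TM)` of smooth (holomorphic if `𝕜 = ℂ`) multivector fields over `V`, with
the wedge product as multiplication. -/
def Multivector (V : Opens M) : Subalgebra 𝕜 (RoughField 𝕜 E V) where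
  carrier := {u | IsSmoothField u}
  mul_mem' {u v} hu hv x := by
    rw [inChart_mul]; exact (hu x).mul (hv x)
  add_mem' {u v} hu hv x := by
    rw [inChart_add]; exact (hu x).add (hv x)
  algebraMap_mem' r x := by
    refine (smoothAt_const (algebraMap 𝕜 _ r) _).congr ?_
    filter_upwards [eventually_symm_mem (𝕜 := 𝕜) (E := E) (x : M) x.2] with y hy
    rw [inChart, extendZero_of_mem _ hy, Pi.algebraMap_apply, AlgHom.commutes]

/-- Restriction `Γ(U, ⋀ TM) → Γ(V, ⋀ TM)` for `V ⊆ U`. -/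
def res {U V : Opens M} (h : V ≤ U) : Multivector 𝕜 E U →ₐ[𝕜] Multivector 𝕜 E V where
  toFun u := ⟨roughRes h u.1, IsSmoothField.roughRes h u.2⟩
  map_one' := rfl
  map_mul' _ _ := rfl
  map_zero' := rfl
  map_add' _ _ := rfl
  commutes' _ := rfl

/-- `u` is a section of `⋀^p TM`. -/
def HasDegree {V : Opens M} (p : ℕ) (u : Multivector 𝕜 E V) : Prop :=
  ∀ x : V, u.1 x ∈ ⋀[𝕜]^p (TangentSpace 𝓘(𝕜, E) (x : M))

variable (𝕜 E M) in
/-- A smooth (holomorphic if `𝕜 = ℂ`) Poisson tensor on `M`: a global section `π` of `⋀² TM` with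
`{π, π} = 0`. -/
structure PoissonTensor where
  /-- the bivector field -/
  tensor : Multivector 𝕜 E (⊤ : Opens M)
  hasDegree : HasDegree 2 tensor
  schouten_self : schouten tensor.1 tensor.1 = 0

/-- The restriction of the Poisson tensor to an open set. -/
def PoissonTensor.on (π : PoissonTensor 𝕜 E M) (V : Opens M) : Multivector 𝕜 E V :=
  res le_top π.tensor

/-! ### Koszul operators -/

variable (𝕜 E) in
/-- A Koszul operator over the open set `U`: an operator `D : ⋀^p TM → ⋀^(p-1) TM` on (the sheaf
of) multivector fields over `U`, that is a family of operators on `Γ(V, ⋀ TM)` for open `V ⊆ U`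
compatible with restrictions, which generates the Schouten bracket. -/
structure KoszulOperator (U : Opens M) where
  /-- the operator on sections over `V ⊆ U` -/
  op : ∀ V : Opens M, V ≤ U → (Multivector 𝕜 E V →ₗ[𝕜] Multivector 𝕜 E V)
  op_res : ∀ (V W : Opens M) (hV : V ≤ U) (hW : W ≤ V) (u : Multivector 𝕜 E V),
    op W (hW.trans hV) (res hW u) = res hW (op V hV u)
  op_degree_zero : ∀ (V : Opens M) (hV : V ≤ U) (u : Multivector 𝕜 E V),
    HasDegree 0 u → op V hV u = 0
  op_degree_succ : ∀ (V : Opens M) (hV : V ≤ U) (p : ℕ) (u : Multivector 𝕜 E V),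
    HasDegree (p + 1) u → HasDegree p (op V hV u)
  generates : ∀ (V : Opens M) (hV : V ≤ U) (p q : ℕ) (u v : Multivector 𝕜 E V),
    HasDegree p u → HasDegree q v →
      schouten u.1 v.1 =
        ((-1 : 𝕜) ^ p • (op V hV (u * v) - op V hV u * v - (-1 : 𝕜) ^ p • (u * op V hV v)) :
          Multivector 𝕜 E V).1

/-- `D² = 0`. -/
def KoszulOperator.SquareZero {U : Opens M} (D : KoszulOperator 𝕜 E U) : Prop :=
  ∀ (V : Opens M) (hV : V ≤ U) (u : Multivector 𝕜 E V), D.op V hV (D.op V hV u) = 0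

/-! ### Poisson and locally hamiltonian vector fields -/

theorem schouten_add_left {V : Opens M} {u u' : RoughField 𝕜 E V} (v : RoughField 𝕜 E V)
    (hu : IsSmoothField u) (hu' : IsSmoothField u') :
    schouten (u + u') v = schouten u v + schouten u' v := by
  funext x
  simp only [schouten, Pi.add_apply, inChart_add]
  rw [flatSchouten_add_left _ (hu x) (hu' x), map_add]

/-- `ξ` is a Poisson vector field: a vector field with `{ξ, π} = 0`. -/
def IsPoisson (π : PoissonTensor 𝕜 E M) {V : Opens M} (ξ : Multivector 𝕜 E V) : Prop :=
  HasDegree 1 ξ ∧ schouten ξ.1 (π.on V).1 = 0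

/-- The group `Der(V)` of Poisson vector fields over `V`. -/
def Der (π : PoissonTensor 𝕜 E M) (V : Opens M) : AddSubgroup (Multivector 𝕜 E V) where
  carrier := {ξ | IsPoisson π ξ}
  zero_mem' := by
    have h := schouten_add_left (π.on V).1 (Multivector 𝕜 E V).zero_mem
      (Multivector 𝕜 E V).zero_mem
    rw [add_zero] at h
    exact ⟨fun x => Submodule.zero_mem _, by simpa using h⟩
  add_mem' {ξ η} hξ hη :=
    ⟨fun x => Submodule.add_mem _ (hξ.1 x) (hη.1 x), by
      have h := schouten_add_left (π.on V).1 ξ.2 η.2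
      rw [hξ.2, hη.2, add_zero] at h
      exact h⟩
  neg_mem' {ξ} hξ :=
    ⟨fun x => Submodule.neg_mem _ (hξ.1 x), by
      have h0 := schouten_add_left (π.on V).1 (Multivector 𝕜 E V).zero_mem
        (Multivector 𝕜 E V).zero_mem
      have h := schouten_add_left (π.on V).1 ξ.2 (-ξ).2
      have e : ξ.1 + (-ξ).1 = 0 := add_neg_cancel ξ.1
      rw [add_zero, left_eq_add] at h0
      rw [e, h0, hξ.2, zero_add] at h
      exact h.symm⟩

/-- The differential of a function at `x`. -/
def differential (H : M → 𝕜) (x : M) : Module.Dual 𝕜 (TangentSpace 𝓘(𝕜, E) x) :=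
  (mfderiv 𝓘(𝕜, E) 𝓘(𝕜, 𝕜) H x : TangentSpace 𝓘(𝕜, E) x →L[𝕜] 𝕜).toLinearMap

/-- `ξ = X_H = i(dH)π` on the open set `W`, for a smooth (holomorphic if `𝕜 = ℂ`) function `H`
on `W` (the values of `H` outside `W` are irrelevant). -/
def IsHamiltonianOn (π : PoissonTensor 𝕜 E M) {V : Opens M} (ξ : Multivector 𝕜 E V)
    (W : Opens M) (hW : W ≤ V) (H : M → 𝕜) : Prop :=
  ContMDiffOn 𝓘(𝕜, E) 𝓘(𝕜, 𝕜) ∞ H (W : Set M) ∧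
    ∀ x : W, ξ.1 ⟨x, hW x.2⟩ = interiorProduct (differential H (x : M)) ((π.on W).1 x)

/-- `ξ` is locally hamiltonian. -/
def IsLocallyHamiltonian (π : PoissonTensor 𝕜 E M) {V : Opens M} (ξ : Multivector 𝕜 E V) : Prop :=
  ∀ x ∈ V, ∃ (W : Opens M) (hW : W ≤ V) (H : M → 𝕜), x ∈ W ∧ IsHamiltonianOn π ξ W hW H

theorem interiorProduct_add_left {V : Type} [AddCommGroup V] [Module 𝕜 V] (α β : Module.Dual 𝕜 V)
    (w : ExteriorAlgebra 𝕜 V) : interiorProduct (α + β) w = interiorProduct α w + interiorProduct β w := by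
  simp [interiorProduct]

theorem interiorProduct_neg_left {V : Type} [AddCommGroup V] [Module 𝕜 V] (α : Module.Dual 𝕜 V)
    (w : ExteriorAlgebra 𝕜 V) : interiorProduct (-α) w = -interiorProduct α w := by
  simp [interiorProduct]

/-- The group `Ham(V)` of locally hamiltonian vector fields over `V`, as a subgroup of `Der(V)`. -/
def Ham (π : PoissonTensor 𝕜 E M) (V : Opens M) : AddSubgroup (Der π V) where
  carrier := {ξ | IsLocallyHamiltonian π ξ.1}
  zero_mem' x hx := by
    refine ⟨V, le_rfl, fun _ => 0, hx, contMDiffOn_const, fun y => ?_⟩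
    have : differential (𝕜 := 𝕜) (E := E) (fun _ : M => (0 : 𝕜)) (y : M) = 0 := by
      simp only [differential, mfderiv_const]
      rfl
    rw [this]
    simp [interiorProduct]
  add_mem' {ξ η} hξ hη x hx := by
    obtain ⟨W, hW, H, hxW, hH, e⟩ := hξ x hx
    obtain ⟨W', hW', H', hxW', hH', e'⟩ := hη x hx
    refine ⟨W ⊓ W', inf_le_left.trans hW, H + H', ⟨hxW, hxW'⟩,
      (hH.mono (fun _ h => h.1)).add (hH'.mono (fun _ h => h.2)), fun y => ?_⟩
    have d : MDifferentiableAt 𝓘(𝕜, E) 𝓘(𝕜, 𝕜) H (y : M) :=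
      (hH.contMDiffAt (W.isOpen.mem_nhds y.2.1)).mdifferentiableAt (by simp)
    have d' : MDifferentiableAt 𝓘(𝕜, E) 𝓘(𝕜, 𝕜) H' (y : M) :=
      (hH'.contMDiffAt (W'.isOpen.mem_nhds y.2.2)).mdifferentiableAt (by simp)
    have hd : differential (𝕜 := 𝕜) (E := E) (H + H') (y : M)
        = differential H (y : M) + differential H' (y : M) := by
      simp only [differential, mfderiv_add d d']
      rfl
    rw [hd, interiorProduct_add_left]
    exact congrArg₂ (· + ·) (e ⟨y, y.2.1⟩) (e' ⟨y, y.2.2⟩)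
  neg_mem' {ξ} hξ x hx := by
    obtain ⟨W, hW, H, hxW, hH, e⟩ := hξ x hx
    refine ⟨W, hW, -H, hxW, hH.neg, fun y => ?_⟩
    have hd : differential (𝕜 := 𝕜) (E := E) (-H) (y : M) = -differential H (y : M) := by
      simp only [differential, mfderiv_neg]
      rfl
    rw [hd, interiorProduct_neg_left]
    exact congrArg Neg.neg (e y)

theorem IsPoisson.res {π : PoissonTensor 𝕜 E M} {U V : Opens M} (h : V ≤ U)
    {ξ : Multivector 𝕜 E U} (hξ : IsPoisson π ξ) : IsPoisson π (res h ξ) := by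
  refine ⟨fun x => hξ.1 ⟨x, h x.2⟩, ?_⟩
  have := schouten_roughRes h ξ.1 (π.on U).1
  rw [hξ.2] at this
  exact this

/-- Restriction of Poisson vector fields. -/
def derRes (π : PoissonTensor 𝕜 E M) {U V : Opens M} (h : V ≤ U) : Der π U →+ Der π V where
  toFun ξ := ⟨res h ξ.1, IsPoisson.res h ξ.2⟩
  map_zero' := rfl
  map_add' _ _ := rfl

theorem ham_le_comap (π : PoissonTensor 𝕜 E M) {U V : Opens M} (h : V ≤ U) :
    Ham π U ≤ (Ham π V).comap (derRes π h) := by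
  intro ξ hξ x hx
  obtain ⟨W, hW, H, hxW, hH, e⟩ := hξ x (h hx)
  exact ⟨W ⊓ V, inf_le_right, H, ⟨hxW, hx⟩, hH.mono (fun _ h => h.1), fun y => e ⟨y, y.2.1⟩⟩

/-! ### The quotient sheaf -/

open CategoryTheory Opposite

/-- The presheaf `V ↦ Der(V) / Ham(V)`. -/
def outerPresheaf (π : PoissonTensor 𝕜 E M) : (Opens M)ᵒᵖ ⥤ AddCommGrpCat.{u} where
  obj V := AddCommGrpCat.of (Der π V.unop ⧸ Ham π V.unop)
  map f := AddCommGrpCat.ofHom (QuotientAddGroup.map _ _ (derRes π f.unop.le)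
    (ham_le_comap π f.unop.le))
  map_id V := by
    ext a
    rfl
  map_comp f g := by
    ext a
    rfl

/-- The quotient sheaf `Der/Ham`: the sheaf associated with `V ↦ Der(V) / Ham(V)`. -/
def outerSheaf (π : PoissonTensor 𝕜 E M) : Sheaf (Opens.grothendieckTopology M) AddCommGrpCat.{u} :=
  (presheafToSheaf (Opens.grothendieckTopology M) AddCommGrpCat.{u}).obj (outerPresheaf π)

/-- Sections of `Der/Ham` over `V`. An outer Poisson vector field is a section over `M`. -/
abbrev OuterField (π : PoissonTensor 𝕜 E M) (V : Opens M) : Type u :=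
  (outerSheaf π).obj.obj (op V)

/-- Restriction of sections of `Der/Ham`. -/
def OuterField.res {π : PoissonTensor 𝕜 E M} {U V : Opens M} (h : V ≤ U) (s : OuterField π U) :
    OuterField π V :=
  (outerSheaf π).obj.map (homOfLE h).op s

/-- The section of `Der/Ham` over `V` defined by a Poisson vector field over `V`. -/
def outerClass {π : PoissonTensor 𝕜 E M} {V : Opens M} (ξ : Der π V) : OuterField π V :=
  (toSheafify (Opens.grothendieckTopology M) (outerPresheaf π)).app (op V)
    (QuotientAddGroup.mk ξ : Der π V ⧸ Ham π V)

end Manifold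

end PoissonGeometry

end

noncomputable section

namespace PoissonGeometry

/-! ### Interior products and degrees in the exterior algebra -/

section Exterior

variable {𝕜 : Type} [RCLike 𝕜] {V W : Type} [AddCommGroup V] [Module 𝕜 V] [AddCommGroup W]
  [Module 𝕜 W]

/-! In a chart, the operator `-∑ i(dx^i) ∂_i` is a Koszul operator of square zero. It generates the
bracket by the Leibniz rule for `∂_i` and the antiderivation rule for `i(dx^i)`
(`flatDivergence_generates`). Its square vanishes because second derivatives are symmetric while
interior products anticommute (`flatDivergence_flatDivergence`). The bracket on the manifold is
defined at each point through the chart preferred there. To compute it over a whole chart domain one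
needs its invariance under coordinate changes, where the terms with second derivatives of the
transition map cancel (`flatSchouten_map`).

That `Dπ` is Poisson is formal. From `{π, π} = 0` one gets `D(π ∧ π) = 2 Dπ ∧ π`; applying `D` again
gives `D(Dπ ∧ π) = 0`, and every term in the formula for `{Dπ, π}` vanishes
(`KoszulOperator.isPoisson_op`).

The class of `Dπ` does not depend on `D`. Two Koszul operators generate the same bracket, so their
difference is an antiderivation that kills functions, hence an interior product `i(α)`
(`KoszulOperator.evalChart_op_sub_op`). In coordinates `α` is the difference of the forms `∑ D(∂_i)
dx^i` and `∑ D'(∂_i) dx^i`. Applying `D² = 0` to `∂_i ∧ ∂_j` shows that each of these forms is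
closed (`KoszulOperator.schouten_op_coordField`). By the Poincaré lemma on a ball they are `dh` and
`dh'`, so `Dπ - D'π` is locally the hamiltonian field of `h - h'`
(`KoszulOperator.derRes_sub_derRes_mem_ham`).

The classes of all `Dπ` thus agree on overlaps. Since local operators exist everywhere, their
domains cover `M`, and the sheaf axiom provides the global section and its uniqueness. The argument
is the same over `ℝ` and `ℂ`. -/

theorem exterior_left_induction {C : ExteriorAlgebra 𝕜 V → Prop}
    (hr : ∀ r, C (algebraMap 𝕜 _ r)) (hadd : ∀ a b, C a → C b → C (a + b))
    (hmul : ∀ x a, C a → C (ExteriorAlgebra.ι 𝕜 x * a)) (a : ExteriorAlgebra 𝕜 V) : C a :=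
  CliffordAlgebra.left_induction (Q := (0 : QuadraticForm 𝕜 V)) hr hadd
    (fun a x h => hmul x a h) a

theorem exteriorPower_induction {C : ℕ → ExteriorAlgebra 𝕜 V → Prop}
    (hr : ∀ r, C 0 (algebraMap 𝕜 _ r)) (hadd : ∀ p a b, C p a → C p b → C p (a + b))
    (hmul : ∀ p x a, a ∈ ⋀[𝕜]^p V → C p a → C (p + 1) (ExteriorAlgebra.ι 𝕜 x * a)) {p : ℕ}
    {a : ExteriorAlgebra 𝕜 V} (ha : a ∈ ⋀[𝕜]^p V) : C p a := by
  refine Submodule.pow_induction_on_left' (LinearMap.range (ExteriorAlgebra.ι 𝕜 (M := V)))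
    (C := fun p a _ => C p a) hr (fun a b p _ _ => hadd p a b) ?_ ha
  rintro _ ⟨x, rfl⟩ p a ha h
  exact hmul p x a ha h

theorem algebraMap_mem_exteriorPower_zero (r : 𝕜) :
    algebraMap 𝕜 (ExteriorAlgebra 𝕜 V) r ∈ ⋀[𝕜]^0 V := by
  rw [ExteriorAlgebra.exteriorPower, pow_zero]; exact Submodule.algebraMap_mem r

theorem ι_mul_mem_exteriorPower {p : ℕ} (x : V) {a : ExteriorAlgebra 𝕜 V} (ha : a ∈ ⋀[𝕜]^p V) :
    ExteriorAlgebra.ι 𝕜 x * a ∈ ⋀[𝕜]^(p + 1) V := by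
  rw [ExteriorAlgebra.exteriorPower, pow_succ']
  exact Submodule.mul_mem_mul ⟨x, rfl⟩ ha

theorem ι_mem_exteriorPower_one (x : V) : ExteriorAlgebra.ι 𝕜 x ∈ ⋀[𝕜]^1 V := by
  rw [ExteriorAlgebra.exteriorPower, pow_one]; exact ⟨x, rfl⟩

theorem exists_algebraMap_of_mem_zero {a : ExteriorAlgebra 𝕜 V} (ha : a ∈ ⋀[𝕜]^0 V) :
    ∃ r, algebraMap 𝕜 _ r = a := by
  rw [ExteriorAlgebra.exteriorPower, pow_zero] at ha; exact Submodule.mem_one.mp ha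

theorem algebraMap_algebraMapInv {a : ExteriorAlgebra 𝕜 V} (ha : a ∈ ⋀[𝕜]^0 V) :
    algebraMap 𝕜 _ (ExteriorAlgebra.algebraMapInv a) = a := by
  obtain ⟨r, rfl⟩ := exists_algebraMap_of_mem_zero ha
  rw [ExteriorAlgebra.algebraMap_leftInverse]

theorem exists_ι_of_mem_one {a : ExteriorAlgebra 𝕜 V} (ha : a ∈ ⋀[𝕜]^1 V) :
    ∃ x, ExteriorAlgebra.ι 𝕜 x = a := by
  rw [ExteriorAlgebra.exteriorPower, pow_one] at ha; exact ha

theorem map_mem_exteriorPower (f : V →ₗ[𝕜] W) {p : ℕ} {a : ExteriorAlgebra 𝕜 V}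
    (ha : a ∈ ⋀[𝕜]^p V) : ExteriorAlgebra.map f a ∈ ⋀[𝕜]^p W := by
  refine exteriorPower_induction (C := fun p a => ExteriorAlgebra.map f a ∈ ⋀[𝕜]^p W) ?_ ?_ ?_ ha
  · intro r; rw [AlgHom.commutes]; exact algebraMap_mem_exteriorPower_zero r
  · intro p a b ha hb; rw [map_add]; exact Submodule.add_mem _ ha hb
  · intro p x a _ h
    rw [map_mul, ExteriorAlgebra.map_apply_ι]
    exact ι_mul_mem_exteriorPower _ h

@[simp] theorem interiorProduct_algebraMap (α : Module.Dual 𝕜 V) (r : 𝕜) :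
    interiorProduct α (algebraMap 𝕜 _ r) = 0 :=
  CliffordAlgebra.contractLeft_algebraMap _ _ _

@[simp] theorem interiorProduct_ι (α : Module.Dual 𝕜 V) (x : V) :
    interiorProduct α (ExteriorAlgebra.ι 𝕜 x) = algebraMap 𝕜 _ (α x) :=
  CliffordAlgebra.contractLeft_ι _ _ _

theorem interiorProduct_ι_mul (α : Module.Dual 𝕜 V) (x : V) (a : ExteriorAlgebra 𝕜 V) :
    interiorProduct α (ExteriorAlgebra.ι 𝕜 x * a)
      = α x • a - ExteriorAlgebra.ι 𝕜 x * interiorProduct α a :=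
  CliffordAlgebra.contractLeft_ι_mul _ _ _

theorem interiorProduct_comm (α β : Module.Dual 𝕜 V) (a : ExteriorAlgebra 𝕜 V) :
    interiorProduct α (interiorProduct β a) = -interiorProduct β (interiorProduct α a) :=
  CliffordAlgebra.contractLeft_comm _ _ _

theorem interiorProduct_smul_left (c : 𝕜) (α : Module.Dual 𝕜 V) (a : ExteriorAlgebra 𝕜 V) :
    interiorProduct (c • α) a = c • interiorProduct α a := by
  simp [interiorProduct]

theorem involute_ι' (x : V) : CliffordAlgebra.involute (ExteriorAlgebra.ι 𝕜 x)
    = -ExteriorAlgebra.ι 𝕜 x :=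
  CliffordAlgebra.involute_ι x

/-- The antiderivation rule follows by building `a` from vectors one at a time. Writing the sign as
the grade involution removes any need for `a` to be homogeneous. -/
theorem interiorProduct_mul (α : Module.Dual 𝕜 V) (a b : ExteriorAlgebra 𝕜 V) :
    interiorProduct α (a * b)
      = interiorProduct α a * b + CliffordAlgebra.involute a * interiorProduct α b := by
  induction a using exterior_left_induction with
  | hr r =>
    rw [interiorProduct_algebraMap, AlgHom.commutes, ← Algebra.smul_def, ← Algebra.smul_def,
      map_smul, zero_mul, zero_add]
  | hadd a a' h h' => rw [add_mul, map_add, h, h', map_add, map_add, add_mul, add_mul]; abel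
  | hmul x a h =>
    rw [mul_assoc, interiorProduct_ι_mul, interiorProduct_ι_mul, h, map_mul, involute_ι', sub_mul,
      smul_mul_assoc, mul_add, ← mul_assoc, ← mul_assoc, neg_mul, neg_mul]
    abel

theorem ι_mul_eq_involute_mul (x : V) (a : ExteriorAlgebra 𝕜 V) :
    ExteriorAlgebra.ι 𝕜 x * a = CliffordAlgebra.involute a * ExteriorAlgebra.ι 𝕜 x := by
  induction a using exterior_left_induction with
  | hr r => rw [AlgHom.commutes, Algebra.commutes]
  | hadd a a' h h' => rw [mul_add, h, h', map_add, add_mul]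
  | hmul y a h =>
    rw [map_mul, involute_ι', mul_assoc, ← h, neg_mul, ← mul_assoc, ← mul_assoc, ← neg_mul,
      eq_neg_of_add_eq_zero_left (ExteriorAlgebra.ι_add_mul_swap x y)]

theorem interiorProduct_map (f : V →ₗ[𝕜] W) (α : Module.Dual 𝕜 W) (a : ExteriorAlgebra 𝕜 V) :
    interiorProduct α (ExteriorAlgebra.map f a)
      = ExteriorAlgebra.map f (interiorProduct (α ∘ₗ f) a) := by
  induction a using exterior_left_induction with
  | hr r => simp
  | hadd a b h h' => simp [h, h']
  | hmul x a h =>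
    rw [map_mul, ExteriorAlgebra.map_apply_ι, interiorProduct_ι_mul, interiorProduct_ι_mul, h,
      map_sub, map_mul, map_smul, ExteriorAlgebra.map_apply_ι]
    rfl

theorem involute_map (f : V →ₗ[𝕜] W) (a : ExteriorAlgebra 𝕜 V) :
    CliffordAlgebra.involute (ExteriorAlgebra.map f a)
      = ExteriorAlgebra.map f (CliffordAlgebra.involute a) := by
  induction a using exterior_left_induction with
  | hr r => simp only [AlgHom.commutes]
  | hadd a b h h' => simp only [map_add, h, h']
  | hmul x a h =>
    simp only [map_mul, ExteriorAlgebra.map_apply_ι, involute_ι', h, map_neg]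

theorem involute_of_mem {p : ℕ} {a : ExteriorAlgebra 𝕜 V} (ha : a ∈ ⋀[𝕜]^p V) :
    CliffordAlgebra.involute a = (-1 : 𝕜) ^ p • a := by
  refine exteriorPower_induction
    (C := fun p a => CliffordAlgebra.involute a = (-1 : 𝕜) ^ p • a) ?_ ?_ ?_ ha
  · intro r; rw [AlgHom.commutes, pow_zero, one_smul]
  · intro p a b ha hb; rw [map_add, ha, hb, smul_add]
  · intro p x a _ h
    rw [map_mul, h, involute_ι', pow_succ, mul_neg_one, neg_smul, mul_smul_comm, neg_mul, smul_neg]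

/-- Both claims go through one induction: passing from degree zero to degree one uses the vanishing
in degree zero. The form `p = q + 1` avoids truncated subtraction. -/
theorem interiorProduct_mem (α : Module.Dual 𝕜 V) {p : ℕ} {a : ExteriorAlgebra 𝕜 V}
    (ha : a ∈ ⋀[𝕜]^p V) :
    (p = 0 → interiorProduct α a = 0) ∧ ∀ q, p = q + 1 → interiorProduct α a ∈ ⋀[𝕜]^q V := by
  refine exteriorPower_induction (C := fun p a => (p = 0 → interiorProduct α a = 0) ∧
    ∀ q, p = q + 1 → interiorProduct α a ∈ ⋀[𝕜]^q V) ?_ ?_ ?_ ha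
  · intro r
    exact ⟨fun _ => by simp, fun q h => by omega⟩
  · intro p a b ha hb
    refine ⟨fun h => by rw [map_add, ha.1 h, hb.1 h, add_zero], fun q h => ?_⟩
    rw [map_add]; exact Submodule.add_mem _ (ha.2 q h) (hb.2 q h)
  · intro p x a ha h
    refine ⟨fun h => by omega, fun q hq => ?_⟩
    obtain rfl : p = q := by omega
    rw [interiorProduct_ι_mul]
    refine Submodule.sub_mem _ (Submodule.smul_mem _ _ ha) ?_
    rcases p with _ | p
    · rw [h.1 rfl, mul_zero]; exact Submodule.zero_mem _
    · exact ι_mul_mem_exteriorPower _ (h.2 p rfl)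

theorem interiorProduct_of_mem_zero (α : Module.Dual 𝕜 V) {a : ExteriorAlgebra 𝕜 V}
    (ha : a ∈ ⋀[𝕜]^0 V) : interiorProduct α a = 0 :=
  (interiorProduct_mem α ha).1 rfl

theorem interiorProduct_mem_of_mem_succ (α : Module.Dual 𝕜 V) {p : ℕ} {a : ExteriorAlgebra 𝕜 V}
    (ha : a ∈ ⋀[𝕜]^(p + 1) V) : interiorProduct α a ∈ ⋀[𝕜]^p V :=
  (interiorProduct_mem α ha).2 p rfl

/-- Euler's formula `∑ e_i ∧ i(e^i) a = p a` for `a` of degree `p`. -/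
theorem sum_ι_mul_interiorProduct {κ : Type*} [Fintype κ] (e : Module.Basis κ 𝕜 V) {p : ℕ}
    {a : ExteriorAlgebra 𝕜 V} (ha : a ∈ ⋀[𝕜]^p V) :
    ∑ i, ExteriorAlgebra.ι 𝕜 (e i) * interiorProduct (e.coord i) a = (p : 𝕜) • a := by
  refine exteriorPower_induction (C := fun p a =>
    ∑ i, ExteriorAlgebra.ι 𝕜 (e i) * interiorProduct (e.coord i) a = (p : 𝕜) • a) ?_ ?_ ?_ ha
  · intro r; simp
  · intro p a b ha hb
    simp only [map_add, mul_add, Finset.sum_add_distrib, ha, hb, smul_add]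
  · intro p x a _ h
    have hx : ∑ i, e.coord i x • ExteriorAlgebra.ι 𝕜 (e i) = ExteriorAlgebra.ι 𝕜 x := by
      conv_rhs => rw [← e.sum_repr x, map_sum]
      simp
    have key : ∀ i, ExteriorAlgebra.ι 𝕜 (e i) *
        interiorProduct (e.coord i) (ExteriorAlgebra.ι 𝕜 x * a)
        = (e.coord i x • ExteriorAlgebra.ι 𝕜 (e i)) * a + ExteriorAlgebra.ι 𝕜 x *
          (ExteriorAlgebra.ι 𝕜 (e i) * interiorProduct (e.coord i) a) := by
      intro i
      rw [interiorProduct_ι_mul, mul_sub, mul_smul_comm, smul_mul_assoc, ← mul_assoc, ← mul_assoc,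
        eq_neg_of_add_eq_zero_left (ExteriorAlgebra.ι_add_mul_swap (e i) x), neg_mul, sub_neg_eq_add]
    rw [Finset.sum_congr rfl fun i _ => key i, Finset.sum_add_distrib, ← Finset.sum_mul,
      ← Finset.mul_sum, hx, h, mul_smul_comm]
    push_cast
    rw [add_smul, one_smul, add_comm]

end Exterior

/-! ### Calculus of functions with values in the exterior algebra -/

section Norm

variable (𝕜 : Type) [RCLike 𝕜] (E : Type) [NormedAddCommGroup E] [NormedSpace 𝕜 E]
  [FiniteDimensional 𝕜 E]

/-- The sup norm of the components. -/
abbrev exteriorNormedAddCommGroup : NormedAddCommGroup (ExteriorAlgebra 𝕜 E) :=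
  NormedAddCommGroup.induced _ _ (wedgeFrame 𝕜 E).equivFun (wedgeFrame 𝕜 E).equivFun.injective

attribute [local instance] exteriorNormedAddCommGroup

/-- The normed space structure of the sup norm of the components. -/
abbrev exteriorNormedSpace : NormedSpace 𝕜 (ExteriorAlgebra 𝕜 E) :=
  NormedSpace.induced 𝕜 _ _ (wedgeFrame 𝕜 E).equivFun

theorem finiteDimensional_exteriorAlgebra : FiniteDimensional 𝕜 (ExteriorAlgebra 𝕜 E) :=
  Module.Finite.of_basis (wedgeFrame 𝕜 E)

end Norm

attribute [local instance] exteriorNormedAddCommGroup exteriorNormedSpace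
  finiteDimensional_exteriorAlgebra

section FlatCalculus

variable {𝕜 : Type} [RCLike 𝕜] {E : Type} [NormedAddCommGroup E] [NormedSpace 𝕜 E]
  [FiniteDimensional 𝕜 E]

/-- The components in the wedge basis form a continuous linear equivalence for the auxiliary norm.
Componentwise calculus can therefore be replaced by `fderiv` of algebra-valued functions. -/
theorem smoothAt_iff {u : E → ExteriorAlgebra 𝕜 E} {y : E} :
    SmoothAt u y ↔ ContDiffAt 𝕜 ∞ u y := by
  rw [← ((wedgeFrame 𝕜 E).equivFun.toContinuousLinearEquiv).comp_contDiffAt_iff, contDiffAt_pi]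
  rfl

theorem partialDeriv_eq_fderiv {u : E → ExteriorAlgebra 𝕜 E} {y : E}
    (hu : DifferentiableAt 𝕜 u y) (i : Fin (Module.finrank 𝕜 E)) :
    partialDeriv i u y = fderiv 𝕜 u y (frame 𝕜 E i) := by
  rw [partialDeriv, ← (wedgeFrame 𝕜 E).sum_repr (fderiv 𝕜 u y (frame 𝕜 E i))]
  refine Finset.sum_congr rfl fun I _ => ?_
  congr 1
  exact congrArg (fun T => T (frame 𝕜 E i))
    (((wedgeFrame 𝕜 E).coord I).toContinuousLinearMap.hasFDerivAt.comp y hu.hasFDerivAt).fderiv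

section Linear

variable {F G : Type*} [NormedAddCommGroup F] [NormedSpace 𝕜 F] [FiniteDimensional 𝕜 F]
  [NormedAddCommGroup G] [NormedSpace 𝕜 G]

theorem _root_.ContDiffAt.linearMap_comp {n : WithTop ℕ∞} (L : F →ₗ[𝕜] G) {u : E → F} {y : E}
    (hu : ContDiffAt 𝕜 n u y) : ContDiffAt 𝕜 n (fun z => L (u z)) y :=
  L.toContinuousLinearMap.contDiff.contDiffAt.comp y hu

theorem _root_.DifferentiableAt.linearMap_comp (L : F →ₗ[𝕜] G) {u : E → F} {y : E}
    (hu : DifferentiableAt 𝕜 u y) : DifferentiableAt 𝕜 (fun z => L (u z)) y :=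
  L.toContinuousLinearMap.differentiableAt.comp y hu

theorem fderiv_linearMap_comp (L : F →ₗ[𝕜] G) {u : E → F} {y : E}
    (hu : DifferentiableAt 𝕜 u y) (w : E) :
    fderiv 𝕜 (fun z => L (u z)) y w = L (fderiv 𝕜 u y w) := by
  exact congrArg (fun T => T w)
    (L.toContinuousLinearMap.hasFDerivAt.comp y hu.hasFDerivAt).fderiv

/-- A derivative of a function with values in a linear subspace lies in that subspace. -/
theorem fderiv_mem_of_eventually_mem (S : Submodule 𝕜 F) {u : E → F} {y : E}
    (hu : DifferentiableAt 𝕜 u y) (h : ∀ᶠ z in 𝓝 y, u z ∈ S) (w : E) : fderiv 𝕜 u y w ∈ S := by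
  by_contra hw
  -- A functional that kills `S` but not the derivative: its composite with `u` vanishes near `y`,
  -- so its derivative there is zero.
  obtain ⟨f, hf, hS⟩ := S.exists_le_ker_of_notMem hw
  apply hf
  rw [← fderiv_linearMap_comp f hu]
  have h0 : (fun z => f (u z)) =ᶠ[𝓝 y] fun _ => 0 := h.mono fun z hz => hS hz
  rw [h0.fderiv_eq]
  simp

end Linear

/-- Wedge product as a continuous bilinear map. -/
def wedgeL : ExteriorAlgebra 𝕜 E →L[𝕜] ExteriorAlgebra 𝕜 E →L[𝕜] ExteriorAlgebra 𝕜 E :=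
  (LinearMap.mul 𝕜 (ExteriorAlgebra 𝕜 E)).toContinuousBilinearMap

theorem _root_.ContDiffAt.wedge {n : WithTop ℕ∞} {u v : E → ExteriorAlgebra 𝕜 E} {y : E}
    (hu : ContDiffAt 𝕜 n u y) (hv : ContDiffAt 𝕜 n v y) :
    ContDiffAt 𝕜 n (fun z => u z * v z) y :=
  (wedgeL (𝕜 := 𝕜) (E := E)).isBoundedBilinearMap.contDiff.contDiffAt.comp y (hu.prodMk hv)

theorem _root_.DifferentiableAt.wedge {u v : E → ExteriorAlgebra 𝕜 E} {y : E}
    (hu : DifferentiableAt 𝕜 u y) (hv : DifferentiableAt 𝕜 v y) :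
    DifferentiableAt 𝕜 (fun z => u z * v z) y :=
  ((wedgeL (𝕜 := 𝕜) (E := E)).hasFDerivAt_of_bilinear hu.hasFDerivAt
    hv.hasFDerivAt).differentiableAt

theorem fderiv_wedge {u v : E → ExteriorAlgebra 𝕜 E} {y : E}
    (hu : DifferentiableAt 𝕜 u y) (hv : DifferentiableAt 𝕜 v y) (w : E) :
    fderiv 𝕜 (fun z => u z * v z) y w = u y * fderiv 𝕜 v y w + fderiv 𝕜 u y w * v y :=
  congrArg (fun T => T w) ((wedgeL (𝕜 := 𝕜) (E := E)).fderiv_of_bilinear hu hv)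

theorem contDiffAt_map_const {n : WithTop ℕ∞} {A : E → E →L[𝕜] E} {y : E}
    (hA : ContDiffAt 𝕜 n A y) (a : ExteriorAlgebra 𝕜 E) :
    ContDiffAt 𝕜 n (fun z => ExteriorAlgebra.map (A z).toLinearMap a) y := by
  induction a using exterior_left_induction with
  | hr r => simp only [AlgHom.commutes]; exact contDiffAt_const
  | hadd a b ha hb => simp only [map_add]; exact ha.add hb
  | hmul x a h =>
    simp only [map_mul, ExteriorAlgebra.map_apply_ι]
    exact ((hA.clm_apply contDiffAt_const).linearMap_comp (ExteriorAlgebra.ι 𝕜)).wedge h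

theorem map_eq_sum_component (A : E →ₗ[𝕜] E) (u : E → ExteriorAlgebra 𝕜 E) (z : E) :
    ExteriorAlgebra.map A (u z)
      = ∑ I, component u I z • ExteriorAlgebra.map A (wedgeFrame 𝕜 E I) := by
  conv_lhs => rw [← (wedgeFrame 𝕜 E).sum_repr (u z), map_sum]
  simp [component]

theorem _root_.ContDiffAt.exteriorMap {n : WithTop ℕ∞} {A : E → E →L[𝕜] E} {y : E}
    (hA : ContDiffAt 𝕜 n A y) {u : E → ExteriorAlgebra 𝕜 E} (hu : ContDiffAt 𝕜 n u y) :
    ContDiffAt 𝕜 n (fun z => ExteriorAlgebra.map (A z).toLinearMap (u z)) y := by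
  simp only [map_eq_sum_component _ u]
  exact ContDiffAt.sum fun I _ =>
    (hu.linearMap_comp ((wedgeFrame 𝕜 E).coord I)).smul (contDiffAt_map_const hA _)

/-- Differentiating a wedge of the vectors `A x_j` replaces one factor at a time by its derivative:
`i(e^k)` removes a factor and the derivative of `A` at `e_k` is put in front. Differentiability is
proved in the same induction because the product rule needs it. -/
theorem fderiv_map_const {A : E → E →L[𝕜] E} {y : E} (hA : DifferentiableAt 𝕜 A y)
    (w : E) (a : ExteriorAlgebra 𝕜 E) :
    DifferentiableAt 𝕜 (fun z => ExteriorAlgebra.map (A z).toLinearMap a) y ∧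
    fderiv 𝕜 (fun z => ExteriorAlgebra.map (A z).toLinearMap a) y w
      = ∑ k, ExteriorAlgebra.ι 𝕜 (fderiv 𝕜 A y w (frame 𝕜 E k)) *
          ExteriorAlgebra.map (A y).toLinearMap (interiorProduct ((frame 𝕜 E).coord k) a) := by
  induction a using exterior_left_induction with
  | hr r => simp only [AlgHom.commutes]; simp
  | hadd a b ha hb =>
    simp only [map_add, mul_add, Finset.sum_add_distrib]
    refine ⟨ha.1.add hb.1, ?_⟩
    rw [fderiv_fun_add ha.1 hb.1, add_apply, ha.2, hb.2]
  | hmul x a h =>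
    have hx : DifferentiableAt 𝕜 (fun z => A z x) y :=
      hA.clm_apply (differentiableAt_const x)
    have hx' : fderiv 𝕜 (fun z => A z x) y w = fderiv 𝕜 A y w x := by
      rw [fderiv_clm_apply hA (differentiableAt_const x)]; simp
    have hι := hx.linearMap_comp (ExteriorAlgebra.ι 𝕜 (M := E))
    simp only [map_mul, ExteriorAlgebra.map_apply_ι, ContinuousLinearMap.coe_coe]
    refine ⟨hι.wedge h.1, ?_⟩
    rw [fderiv_wedge hι h.1, fderiv_linearMap_comp _ hx, hx', h.2]
    have hs : ∑ k, (frame 𝕜 E).coord k x • ExteriorAlgebra.ι 𝕜 (fderiv 𝕜 A y w (frame 𝕜 E k))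
        = ExteriorAlgebra.ι 𝕜 (fderiv 𝕜 A y w x) := by
      conv_rhs => rw [← (frame 𝕜 E).sum_repr x, map_sum, map_sum]
      simp
    have key : ∀ k, ExteriorAlgebra.ι 𝕜 (fderiv 𝕜 A y w (frame 𝕜 E k)) *
        ExteriorAlgebra.map (A y).toLinearMap
          (interiorProduct ((frame 𝕜 E).coord k) (ExteriorAlgebra.ι 𝕜 x * a))
        = ((frame 𝕜 E).coord k x • ExteriorAlgebra.ι 𝕜 (fderiv 𝕜 A y w (frame 𝕜 E k))) *
            ExteriorAlgebra.map (A y).toLinearMap a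
          + ExteriorAlgebra.ι 𝕜 (A y x) *
            (ExteriorAlgebra.ι 𝕜 (fderiv 𝕜 A y w (frame 𝕜 E k)) *
              ExteriorAlgebra.map (A y).toLinearMap
                (interiorProduct ((frame 𝕜 E).coord k) a)) := by
      intro k
      rw [interiorProduct_ι_mul, map_sub, map_smul, map_mul, ExteriorAlgebra.map_apply_ι, mul_sub,
        mul_smul_comm, smul_mul_assoc, ← mul_assoc, ← mul_assoc, ContinuousLinearMap.coe_coe,
        eq_neg_of_add_eq_zero_left (ExteriorAlgebra.ι_add_mul_swap _ (A y x)), neg_mul,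
        sub_neg_eq_add]
    rw [Finset.sum_congr rfl fun k _ => key k, Finset.sum_add_distrib, ← Finset.sum_mul,
      ← Finset.mul_sum, hs, add_comm]

theorem fderiv_exteriorMap {A : E → E →L[𝕜] E} {u : E → ExteriorAlgebra 𝕜 E} {y : E}
    (hA : DifferentiableAt 𝕜 A y) (hu : DifferentiableAt 𝕜 u y) (w : E) :
    fderiv 𝕜 (fun z => ExteriorAlgebra.map (A z).toLinearMap (u z)) y w
      = ExteriorAlgebra.map (A y).toLinearMap (fderiv 𝕜 u y w) +
        ∑ k, ExteriorAlgebra.ι 𝕜 (fderiv 𝕜 A y w (frame 𝕜 E k)) *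
          ExteriorAlgebra.map (A y).toLinearMap (interiorProduct ((frame 𝕜 E).coord k) (u y)) := by
  have hc : ∀ I, DifferentiableAt 𝕜 (component u I) y := fun I =>
    hu.linearMap_comp ((wedgeFrame 𝕜 E).coord I)
  have hc' : ∀ I, fderiv 𝕜 (component u I) y w
      = (wedgeFrame 𝕜 E).repr (fderiv 𝕜 u y w) I := fun I =>
    fderiv_linearMap_comp ((wedgeFrame 𝕜 E).coord I) hu w
  simp only [map_eq_sum_component _ u]
  rw [fderiv_fun_sum fun I _ => (hc I).fun_smul (fderiv_map_const hA w _).1,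
    sum_apply]
  have h1 : ∀ I, fderiv 𝕜 (fun z => component u I z •
      ExteriorAlgebra.map (A z).toLinearMap (wedgeFrame 𝕜 E I)) y w
      = component u I y • (∑ k, ExteriorAlgebra.ι 𝕜 (fderiv 𝕜 A y w (frame 𝕜 E k)) *
          ExteriorAlgebra.map (A y).toLinearMap
            (interiorProduct ((frame 𝕜 E).coord k) (wedgeFrame 𝕜 E I)))
        + (wedgeFrame 𝕜 E).repr (fderiv 𝕜 u y w) I •
          ExteriorAlgebra.map (A y).toLinearMap (wedgeFrame 𝕜 E I) := by
    intro I
    rw [fderiv_fun_smul (hc I) (fderiv_map_const hA w _).1, ← hc' I,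
      ← (fderiv_map_const hA w _).2]
    rfl
  rw [Finset.sum_congr rfl fun I _ => h1 I, Finset.sum_add_distrib, add_comm]
  congr 1
  · conv_rhs => rw [← (wedgeFrame 𝕜 E).sum_repr (fderiv 𝕜 u y w), map_sum]
    simp
  · simp only [Finset.smul_sum]
    rw [Finset.sum_comm]
    refine Finset.sum_congr rfl fun k _ => ?_
    conv_rhs => rw [← (wedgeFrame 𝕜 E).sum_repr (u y)]
    simp only [map_sum, map_smul, Finset.mul_sum, mul_smul_comm]
    rfl

end FlatCalculus

/-! ### Invariance of the Schouten bracket under changes of coordinates -/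

section FlatBracket

variable {𝕜 : Type} [RCLike 𝕜] {E : Type} [NormedAddCommGroup E] [NormedSpace 𝕜 E]
  [FiniteDimensional 𝕜 E]

theorem minSmoothness_two_le_infty : minSmoothness 𝕜 2 ≤ (∞ : WithTop ℕ∞) := by
  rw [minSmoothness_of_isRCLikeNormedField]
  exact WithTop.coe_le_coe.2 (le_top : (2 : ℕ∞) ≤ ⊤)

theorem eq_zero_of_eq_neg_self {N : Type*} [AddCommGroup N] [Module 𝕜 N] {a : N} (h : a = -a) :
    a = 0 := by
  have h2 : (2 : 𝕜) • a = 0 := by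
    rw [two_smul]
    exact add_eq_zero_iff_eq_neg.2 h
  exact (smul_eq_zero.1 h2).resolve_left two_ne_zero

/-- The tensor `∑ e^i ⊗ e_i` represents the identity, so an endomorphism can be moved from one slot
to the other. This absorbs the Jacobian in a change of coordinates. -/
theorem sum_coord_comp {N : Type*} [AddCommGroup N] [Module 𝕜 N]
    (b : Module.Dual 𝕜 E →ₗ[𝕜] E →ₗ[𝕜] N) (A : E →ₗ[𝕜] E) :
    ∑ i, b ((frame 𝕜 E).coord i ∘ₗ A) (frame 𝕜 E i)
      = ∑ i, b ((frame 𝕜 E).coord i) (A (frame 𝕜 E i)) := by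
  have h1 : ∀ i, (frame 𝕜 E).coord i ∘ₗ A
      = ∑ j, (frame 𝕜 E).coord i (A (frame 𝕜 E j)) • (frame 𝕜 E).coord j := by
    intro i
    refine (frame 𝕜 E).ext fun k => ?_
    simp [LinearMap.sum_apply, Finsupp.single_apply]
  have h2 : ∀ j, A (frame 𝕜 E j)
      = ∑ i, (frame 𝕜 E).coord i (A (frame 𝕜 E j)) • frame 𝕜 E i := fun j =>
    ((frame 𝕜 E).sum_repr _).symm
  conv_rhs => enter [2, i]; rw [h2 i]
  conv_lhs => enter [2, i]; rw [h1 i]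
  simp only [map_sum, map_smul, LinearMap.sum_apply, LinearMap.smul_apply]
  exact Finset.sum_comm

theorem involute_interiorProduct (α : Module.Dual 𝕜 E) (a : ExteriorAlgebra 𝕜 E) :
    CliffordAlgebra.involute (interiorProduct α a)
      = -interiorProduct α (CliffordAlgebra.involute a) := by
  induction a using exterior_left_induction with
  | hr r => rw [AlgHom.commutes, interiorProduct_algebraMap]; simp
  | hadd a b ha hb => simp only [map_add, ha, hb]; abel
  | hmul x a h =>
    rw [interiorProduct_ι_mul, map_sub, map_smul, map_mul, map_mul, involute_ι', h, neg_mul,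
      neg_mul, map_neg, interiorProduct_ι_mul, mul_neg]
    abel

/-- The chain rule for `u' ∘ τ` against the product rule for the pushed-forward field. The sum over
`k` measures how far componentwise differentiation is from being tensorial. -/
theorem fderiv_of_eventuallyEq_exteriorMap {τ : E → E} {y : E} (hτ : ContDiffAt 𝕜 ∞ τ y)
    {u u' : E → ExteriorAlgebra 𝕜 E} (hu : DifferentiableAt 𝕜 u y)
    (hu' : DifferentiableAt 𝕜 u' (τ y))
    (h : ∀ᶠ z in 𝓝 y, u' (τ z) = ExteriorAlgebra.map (fderiv 𝕜 τ z).toLinearMap (u z)) (w : E) :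
    fderiv 𝕜 u' (τ y) (fderiv 𝕜 τ y w)
      = ExteriorAlgebra.map (fderiv 𝕜 τ y).toLinearMap (fderiv 𝕜 u y w) +
        ∑ k, ExteriorAlgebra.ι 𝕜 (fderiv 𝕜 (fderiv 𝕜 τ) y w (frame 𝕜 E k)) *
          ExteriorAlgebra.map (fderiv 𝕜 τ y).toLinearMap
            (interiorProduct ((frame 𝕜 E).coord k) (u y)) := by
  have hA : DifferentiableAt 𝕜 (fderiv 𝕜 τ) y :=
    (hτ.fderiv_right (m := ∞) (by simp)).differentiableAt (by simp)
  rw [← fderiv_exteriorMap hA hu w]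
  have h' : (u' ∘ τ) =ᶠ[𝓝 y]
      fun z => ExteriorAlgebra.map (fderiv 𝕜 τ z).toLinearMap (u z) := h
  rw [← h'.fderiv_eq, fderiv_comp y hu' (hτ.differentiableAt (by simp))]
  rfl

/-- Each half of the bracket acquires a correction with the second derivative of `τ`; symmetry of
that derivative makes the two equal, and they cancel. Relatedness of the fields near the point
suffices; invertibility of `τ` plays no role. -/
theorem flatSchouten_map {τ : E → E} {y : E} (hτ : ContDiffAt 𝕜 ∞ τ y)
    {u v u' v' : E → ExteriorAlgebra 𝕜 E} (hu : SmoothAt u y) (hv : SmoothAt v y)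
    (hu' : SmoothAt u' (τ y)) (hv' : SmoothAt v' (τ y))
    (h : ∀ᶠ z in 𝓝 y, u' (τ z) = ExteriorAlgebra.map (fderiv 𝕜 τ z).toLinearMap (u z))
    (k : ∀ᶠ z in 𝓝 y, v' (τ z) = ExteriorAlgebra.map (fderiv 𝕜 τ z).toLinearMap (v z)) :
    flatSchouten u' v' (τ y)
      = ExteriorAlgebra.map (fderiv 𝕜 τ y).toLinearMap (flatSchouten u v y) := by
  have du := (smoothAt_iff.1 hu).differentiableAt (by simp)
  have dv := (smoothAt_iff.1 hv).differentiableAt (by simp)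
  have du' := (smoothAt_iff.1 hu').differentiableAt (by simp)
  have dv' := (smoothAt_iff.1 hv').differentiableAt (by simp)
  set A := (fderiv 𝕜 τ y).toLinearMap with hA
  have eu := fderiv_of_eventuallyEq_exteriorMap hτ du du' h
  have ev := fderiv_of_eventuallyEq_exteriorMap hτ dv dv' k
  have hsymm : IsSymmSndFDerivAt 𝕜 τ y := hτ.isSymmSndFDerivAt minSmoothness_two_le_infty
  set B := fderiv 𝕜 (fderiv 𝕜 τ) y
  simp only [flatSchouten, partialDeriv_eq_fderiv du, partialDeriv_eq_fderiv dv,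
    partialDeriv_eq_fderiv du', partialDeriv_eq_fderiv dv', h.self_of_nhds, k.self_of_nhds,
    ← hA, interiorProduct_map]
  let b₁ : Module.Dual 𝕜 E →ₗ[𝕜] E →ₗ[𝕜] ExteriorAlgebra 𝕜 E := LinearMap.mk₂ 𝕜
    (fun α x => CliffordAlgebra.involute (ExteriorAlgebra.map A (interiorProduct α (u y))) *
      fderiv 𝕜 v' (τ y) x)
    (fun α β x => by rw [interiorProduct_add_left, map_add, map_add, add_mul])
    (fun c α x => by rw [interiorProduct_smul_left, map_smul, map_smul, smul_mul_assoc])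
    (fun α x x' => by rw [map_add, mul_add])
    (fun c α x => by rw [map_smul, mul_smul_comm])
  let b₂ : Module.Dual 𝕜 E →ₗ[𝕜] E →ₗ[𝕜] ExteriorAlgebra 𝕜 E := LinearMap.mk₂ 𝕜
    (fun α x => fderiv 𝕜 u' (τ y) x * ExteriorAlgebra.map A (interiorProduct α (v y)))
    (fun α β x => by rw [interiorProduct_add_left, map_add, mul_add])
    (fun c α x => by rw [interiorProduct_smul_left, map_smul, mul_smul_comm])
    (fun α x x' => by rw [map_add, add_mul])
    (fun c α x => by rw [map_smul, smul_mul_assoc])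
  have s₁ := sum_coord_comp b₁ A
  have s₂ := sum_coord_comp b₂ A
  simp only [b₁, b₂, LinearMap.mk₂_apply, hA, ContinuousLinearMap.coe_coe, eu, ev] at s₁ s₂
  rw [← hA] at s₁ s₂
  rw [Finset.sum_sub_distrib, s₁, s₂, map_sum]
  -- Moving the vector to the front cancels the grade involution, and symmetry swaps its arguments.
  -- After exchanging the sums this is the correction from the other half.
  have e₁ : ∀ i l, CliffordAlgebra.involute (ExteriorAlgebra.map A
      (interiorProduct ((frame 𝕜 E).coord i) (u y))) *
        (ExteriorAlgebra.ι 𝕜 (B (frame 𝕜 E i) (frame 𝕜 E l)) *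
          ExteriorAlgebra.map A (interiorProduct ((frame 𝕜 E).coord l) (v y)))
      = ExteriorAlgebra.ι 𝕜 (B (frame 𝕜 E l) (frame 𝕜 E i)) *
        ExteriorAlgebra.map A (interiorProduct ((frame 𝕜 E).coord i) (u y)) *
          ExteriorAlgebra.map A (interiorProduct ((frame 𝕜 E).coord l) (v y)) := by
    intro i l
    rw [← mul_assoc, ← ι_mul_eq_involute_mul, hsymm]
  simp only [mul_add, add_mul, Finset.mul_sum, Finset.sum_mul, Finset.sum_add_distrib, e₁, map_sub,
    map_mul, Finset.sum_sub_distrib, ← involute_map]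
  rw [Finset.sum_comm (f := fun i l => ExteriorAlgebra.ι 𝕜 (B (frame 𝕜 E l) (frame 𝕜 E i)) * _ * _)]
  abel

/-! ### The divergence operator -/

/-- The operator `-∑ i(dx^i) ∂_i`. -/
def flatDivergence (u : E → ExteriorAlgebra 𝕜 E) (y : E) : ExteriorAlgebra 𝕜 E :=
  -∑ i, interiorProduct ((frame 𝕜 E).coord i) (partialDeriv i u y)

theorem flatDivergence_congr {u v : E → ExteriorAlgebra 𝕜 E} {y : E} (h : u =ᶠ[𝓝 y] v) :
    flatDivergence u y = flatDivergence v y := by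
  simp only [flatDivergence, partialDeriv_congr h]

theorem flatDivergence_eq {u : E → ExteriorAlgebra 𝕜 E} {y : E} (hu : DifferentiableAt 𝕜 u y) :
    flatDivergence u y
      = -∑ i, interiorProduct ((frame 𝕜 E).coord i) (fderiv 𝕜 u y (frame 𝕜 E i)) := by
  simp only [flatDivergence, partialDeriv_eq_fderiv hu]

theorem SmoothAt.eventually_differentiableAt {u : E → ExteriorAlgebra 𝕜 E} {y : E}
    (hu : SmoothAt u y) : ∀ᶠ z in 𝓝 y, DifferentiableAt 𝕜 u z := by
  have h1 : ContDiffAt 𝕜 1 u y := (smoothAt_iff.1 hu).of_le (by exact_mod_cast le_top)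
  filter_upwards [h1.eventually (by simp)] with z hz
  exact hz.differentiableAt (by simp)

theorem flatDivergence_eventuallyEq {u : E → ExteriorAlgebra 𝕜 E} {y : E} (hu : SmoothAt u y) :
    flatDivergence u =ᶠ[𝓝 y] fun z =>
      -∑ i, interiorProduct ((frame 𝕜 E).coord i) (fderiv 𝕜 u z (frame 𝕜 E i)) := by
  filter_upwards [hu.eventually_differentiableAt] with z hz
  exact flatDivergence_eq hz

theorem SmoothAt.fderiv_apply {u : E → ExteriorAlgebra 𝕜 E} {y : E} (hu : SmoothAt u y) (w : E) :
    ContDiffAt 𝕜 ∞ (fun z => fderiv 𝕜 u z w) y :=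
  ((smoothAt_iff.1 hu).fderiv_right (m := ∞) (by simp)).clm_apply contDiffAt_const

theorem SmoothAt.flatDivergence {u : E → ExteriorAlgebra 𝕜 E} {y : E} (hu : SmoothAt u y) :
    SmoothAt (flatDivergence u) y := by
  rw [smoothAt_iff]
  refine ContDiffAt.congr_of_eventuallyEq ?_ (flatDivergence_eventuallyEq hu)
  exact (ContDiffAt.sum fun i _ => (hu.fderiv_apply (frame 𝕜 E i)).linearMap_comp _).neg

theorem flatDivergence_add {u v : E → ExteriorAlgebra 𝕜 E} {y : E} (hu : SmoothAt u y)
    (hv : SmoothAt v y) : flatDivergence (u + v) y = flatDivergence u y + flatDivergence v y := by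
  simp only [flatDivergence, partialDeriv_add hu hv, map_add, Finset.sum_add_distrib, neg_add]

theorem flatDivergence_smul {u : E → ExteriorAlgebra 𝕜 E} {y : E} (hu : SmoothAt u y) (c : 𝕜) :
    flatDivergence (c • u) y = c • flatDivergence u y := by
  have du := (smoothAt_iff.1 hu).differentiableAt (by simp)
  rw [flatDivergence_eq du, flatDivergence_eq (du.const_smul c), fderiv_const_smul du]
  simp [Finset.smul_sum]

theorem flatDivergence_mem_zero {u : E → ExteriorAlgebra 𝕜 E} {y : E} (hu : SmoothAt u y)
    (h : ∀ᶠ z in 𝓝 y, u z ∈ ⋀[𝕜]^0 E) : flatDivergence u y = 0 := by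
  have du := (smoothAt_iff.1 hu).differentiableAt (by simp)
  rw [flatDivergence_eq du, Finset.sum_eq_zero, neg_zero]
  exact fun i _ => interiorProduct_of_mem_zero _ (fderiv_mem_of_eventually_mem _ du h _)

theorem flatDivergence_mem {u : E → ExteriorAlgebra 𝕜 E} {y : E} (hu : SmoothAt u y) {p : ℕ}
    (h : ∀ᶠ z in 𝓝 y, u z ∈ ⋀[𝕜]^(p + 1) E) : flatDivergence u y ∈ ⋀[𝕜]^p E := by
  have du := (smoothAt_iff.1 hu).differentiableAt (by simp)
  rw [flatDivergence_eq du]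
  exact Submodule.neg_mem _ (Submodule.sum_mem _ fun i _ =>
    interiorProduct_mem_of_mem_succ _ (fderiv_mem_of_eventually_mem _ du h _))

/-- Expanding `i(dx^i) ∂_i (u ∧ v)` gives four terms. Two are the products subtracted on the right;
the other two, in which `∂_i` and `i(dx^i)` hit different factors, form the bracket up to `(-1)^p`.
Only `u` has to be homogeneous. -/
theorem flatDivergence_generates {u v : E → ExteriorAlgebra 𝕜 E} {y : E} (hu : SmoothAt u y)
    (hv : SmoothAt v y) {p : ℕ} (h : ∀ᶠ z in 𝓝 y, u z ∈ ⋀[𝕜]^p E) :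
    flatSchouten u v y = (-1 : 𝕜) ^ p • (flatDivergence (u * v) y - flatDivergence u y * v y
      - (-1 : 𝕜) ^ p • (u y * flatDivergence v y)) := by
  have du := (smoothAt_iff.1 hu).differentiableAt (by simp)
  have dv := (smoothAt_iff.1 hv).differentiableAt (by simp)
  have duv : DifferentiableAt 𝕜 (u * v) y := du.wedge dv
  have e : ∀ w, fderiv 𝕜 (u * v) y w = u y * fderiv 𝕜 v y w + fderiv 𝕜 u y w * v y :=
    fderiv_wedge du dv
  have i1 : ∀ w, CliffordAlgebra.involute (fderiv 𝕜 u y w) = (-1 : 𝕜) ^ p • fderiv 𝕜 u y w :=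
    fun w => involute_of_mem (fderiv_mem_of_eventually_mem _ du h w)
  have i2 : CliffordAlgebra.involute (u y) = (-1 : 𝕜) ^ p • u y :=
    involute_of_mem h.self_of_nhds
  have sq : (-1 : 𝕜) ^ p * (-1 : 𝕜) ^ p = 1 := by rw [← mul_pow]; simp
  rw [flatDivergence_eq du, flatDivergence_eq dv, flatDivergence_eq duv]
  simp only [flatSchouten, partialDeriv_eq_fderiv du, partialDeriv_eq_fderiv dv, e, map_add,
    interiorProduct_mul, i1, i2, involute_interiorProduct, map_smul, smul_mul_assoc, neg_mul,
    mul_neg, Finset.sum_mul, Finset.mul_sum, Finset.sum_add_distrib, Finset.sum_sub_distrib,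
    smul_sub, smul_neg, smul_add, smul_smul, sq, one_smul, Finset.sum_neg_distrib, neg_add,
    ← Finset.smul_sum]
  abel

theorem flatDivergence_flatDivergence {u : E → ExteriorAlgebra 𝕜 E} {y : E} (hu : SmoothAt u y) :
    flatDivergence (flatDivergence u) y = 0 := by
  have hd : ∀ w, DifferentiableAt 𝕜 (fun z => fderiv 𝕜 u z w) y := fun w =>
    (hu.fderiv_apply w).differentiableAt (by simp)
  have hD : DifferentiableAt 𝕜 (fderiv 𝕜 u) y :=
    ((smoothAt_iff.1 hu).fderiv_right (m := ∞) (by simp)).differentiableAt (by simp)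
  have hdd : ∀ w w', fderiv 𝕜 (fun z => fderiv 𝕜 u z w) y w' = fderiv 𝕜 (fderiv 𝕜 u) y w' w := by
    intro w w'
    rw [fderiv_clm_apply hD (differentiableAt_const w)]; simp
  have hi : ∀ j, DifferentiableAt 𝕜 (fun z => interiorProduct ((frame 𝕜 E).coord j)
      (fderiv 𝕜 u z (frame 𝕜 E j))) y := fun j => (hd _).linearMap_comp _
  have hsymm : IsSymmSndFDerivAt 𝕜 u y := (smoothAt_iff.1 hu).isSymmSndFDerivAt minSmoothness_two_le_infty
  rw [flatDivergence_congr (flatDivergence_eventuallyEq hu),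
    flatDivergence_eq (DifferentiableAt.fun_sum fun j _ => hi j).fun_neg]
  have e : ∀ w, fderiv 𝕜 (fun z => -∑ j, interiorProduct ((frame 𝕜 E).coord j)
      (fderiv 𝕜 u z (frame 𝕜 E j))) y w
      = -∑ j, interiorProduct ((frame 𝕜 E).coord j)
        (fderiv 𝕜 (fderiv 𝕜 u) y w (frame 𝕜 E j)) := by
    intro w
    rw [fderiv_fun_neg, fderiv_fun_sum fun j _ => hi j, neg_apply, sum_apply]
    simp only [fderiv_linearMap_comp _ (hd _), hdd]
  simp only [e, map_neg, map_sum, Finset.sum_neg_distrib, neg_neg]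
  -- Exchanging the two indices changes the sign of the interior products and preserves the second
  -- derivative, so the double sum is its own negative.
  refine eq_zero_of_eq_neg_self (𝕜 := 𝕜) ?_
  rw [← Finset.sum_neg_distrib, Finset.sum_comm]
  refine Finset.sum_congr rfl fun i _ => ?_
  rw [← Finset.sum_neg_distrib]
  refine Finset.sum_congr rfl fun j _ => ?_
  rw [interiorProduct_comm, hsymm]

end FlatBracket

/-! ### Multivector fields in an arbitrary preferred chart -/

section Charts

variable {𝕜 : Type} [RCLike 𝕜] {E : Type} [NormedAddCommGroup E] [NormedSpace 𝕜 E]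
  [FiniteDimensional 𝕜 E] {M : Type u} [TopologicalSpace M] [ChartedSpace E M]

theorem inChart_apply {b : M} {V : Opens M} (u : RoughField 𝕜 E V) {x : M}
    (hx : x ∈ (extChartAt 𝓘(𝕜, E) b).source) :
    inChart b u (extChartAt 𝓘(𝕜, E) b x)
      = ExteriorAlgebra.map (chartDeriv b x).toLinearMap (extendZero u x) :=
  congrArg (fun p => ExteriorAlgebra.map (chartDeriv b p).toLinearMap (extendZero u p))
    ((extChartAt 𝓘(𝕜, E) b).left_inv hx)

theorem inChart_smul (b : M) {V : Opens M} (c : 𝕜) (u : RoughField 𝕜 E V) :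
    inChart b (c • u) = c • inChart b u := by
  funext y
  by_cases h : (extChartAt 𝓘(𝕜, E) b).symm y ∈ V
  · rw [Pi.smul_apply, inChart, inChart, extendZero_of_mem _ h, extendZero_of_mem _ h,
      Pi.smul_apply, map_smul]
  · rw [Pi.smul_apply, inChart, inChart, extendZero_of_notMem _ h, extendZero_of_notMem _ h,
      map_zero, smul_zero]

theorem eventually_symm_mem_of_mem_source {b x : M} {V : Opens M} (hx : x ∈ V)
    (hb : x ∈ (extChartAt 𝓘(𝕜, E) b).source) :
    ∀ᶠ y in 𝓝 (extChartAt 𝓘(𝕜, E) b x), (extChartAt 𝓘(𝕜, E) b).symm y ∈ V := by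
  refine (continuousAt_extChartAt_symm' hb).eventually_mem ?_
  rw [(extChartAt 𝓘(𝕜, E) b).left_inv hb]
  exact V.isOpen.mem_nhds hx

theorem eventually_mem_target {b x : M} (hb : x ∈ (extChartAt 𝓘(𝕜, E) b).source) :
    ∀ᶠ y in 𝓝 (extChartAt 𝓘(𝕜, E) b x), y ∈ (extChartAt 𝓘(𝕜, E) b).target :=
  extChartAt_target_mem_nhds' ((extChartAt 𝓘(𝕜, E) b).map_source hb)

theorem inChart_roughRes_of_mem_source {b : M} {U V : Opens M} (h : V ≤ U) (u : RoughField 𝕜 E U)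
    {x : M} (hx : x ∈ V) (hb : x ∈ (extChartAt 𝓘(𝕜, E) b).source) :
    inChart b (roughRes h u) =ᶠ[𝓝 (extChartAt 𝓘(𝕜, E) b x)] inChart b u := by
  filter_upwards [eventually_symm_mem_of_mem_source hx hb] with y hy
  rw [inChart, inChart, extendZero_of_mem _ hy, extendZero_of_mem _ (h hy), roughRes]

theorem inChart_mem_exteriorPower (b : M) {V : Opens M} {p : ℕ} {u : Multivector 𝕜 E V}
    (hu : HasDegree p u) (y : E) : inChart b u.1 y ∈ ⋀[𝕜]^p E := by
  rw [inChart]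
  refine map_mem_exteriorPower _ ?_
  by_cases h : (extChartAt 𝓘(𝕜, E) b).symm y ∈ V
  · rw [extendZero_of_mem _ h]; exact hu ⟨_, h⟩
  · rw [extendZero_of_notMem _ h]; exact Submodule.zero_mem _

variable [IsManifold 𝓘(𝕜, E) ∞ M]

theorem isInvertible_chartDeriv {b x : M} (hx : x ∈ (extChartAt 𝓘(𝕜, E) b).source) :
    (chartDeriv (𝕜 := 𝕜) (E := E) b x).IsInvertible :=
  have : IsManifold 𝓘(𝕜, E) 1 M := IsManifold.of_le (n := ∞) (by exact_mod_cast le_top)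
  isInvertible_mfderiv_extChartAt hx

theorem map_chartDeriv_inverse {b x : M} (hx : x ∈ (extChartAt 𝓘(𝕜, E) b).source)
    (a : ExteriorAlgebra 𝕜 E) :
    ExteriorAlgebra.map (chartDeriv b x).toLinearMap
      (ExteriorAlgebra.map (chartDeriv (𝕜 := 𝕜) (E := E) b x).inverse.toLinearMap a) = a := by
  obtain ⟨e, he⟩ := isInvertible_chartDeriv (𝕜 := 𝕜) (E := E) hx
  rw [← AlgHom.comp_apply, ExteriorAlgebra.map_comp_map, ← he, ContinuousLinearMap.inverse_equiv]
  have : (e : TangentSpace 𝓘(𝕜, E) x →L[𝕜] E).toLinearMap ∘ₗ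
      (e.symm : E →L[𝕜] TangentSpace 𝓘(𝕜, E) x).toLinearMap = LinearMap.id := by
    ext v; simp
  rw [this, ExteriorAlgebra.map_id, AlgHom.id_apply]

theorem map_inverse_chartDeriv {b x : M} (hx : x ∈ (extChartAt 𝓘(𝕜, E) b).source)
    (a : Fibre 𝕜 E x) :
    ExteriorAlgebra.map (chartDeriv (𝕜 := 𝕜) (E := E) b x).inverse.toLinearMap
      (ExteriorAlgebra.map (chartDeriv b x).toLinearMap a) = a := by
  obtain ⟨e, he⟩ := isInvertible_chartDeriv (𝕜 := 𝕜) (E := E) hx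
  rw [← AlgHom.comp_apply, ExteriorAlgebra.map_comp_map, ← he, ContinuousLinearMap.inverse_equiv]
  have : (e.symm : E →L[𝕜] TangentSpace 𝓘(𝕜, E) x).toLinearMap ∘ₗ
      (e : TangentSpace 𝓘(𝕜, E) x →L[𝕜] E).toLinearMap = LinearMap.id := by
    ext v; simp
  rw [this, ExteriorAlgebra.map_id, AlgHom.id_apply]

theorem map_chartDeriv_injective {b x : M} (hx : x ∈ (extChartAt 𝓘(𝕜, E) b).source) :
    Function.Injective
      (ExteriorAlgebra.map (chartDeriv (𝕜 := 𝕜) (E := E) b x).toLinearMap) :=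
  Function.LeftInverse.injective (map_inverse_chartDeriv hx)

theorem contDiffAt_transition {a b x : M} (ha : x ∈ (extChartAt 𝓘(𝕜, E) a).source)
    (hb : x ∈ (extChartAt 𝓘(𝕜, E) b).source) :
    ContDiffAt 𝕜 ∞ (extChartAt 𝓘(𝕜, E) b ∘ (extChartAt 𝓘(𝕜, E) a).symm)
      (extChartAt 𝓘(𝕜, E) a x) := by
  have h := contDiffWithinAt_ext_coord_change (I := 𝓘(𝕜, E)) (n := ∞) b a
    (y := extChartAt 𝓘(𝕜, E) a x) (by
      rw [PartialEquiv.trans_source, PartialEquiv.symm_source]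
      refine ⟨(extChartAt 𝓘(𝕜, E) a).map_source ha, ?_⟩
      rw [Set.mem_preimage, (extChartAt 𝓘(𝕜, E) a).left_inv ha]
      exact hb)
  rwa [ModelWithCorners.range_eq_univ, contDiffWithinAt_univ] at h

theorem chartDeriv_eq_comp {a b x : M} (ha : x ∈ (extChartAt 𝓘(𝕜, E) a).source)
    (hb : x ∈ (extChartAt 𝓘(𝕜, E) b).source) :
    chartDeriv b x = (fderiv 𝕜 (extChartAt 𝓘(𝕜, E) b ∘ (extChartAt 𝓘(𝕜, E) a).symm)
      (extChartAt 𝓘(𝕜, E) a x)).comp (chartDeriv a x) := by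
  have : IsManifold 𝓘(𝕜, E) 1 M := IsManifold.of_le (n := ∞) (by exact_mod_cast le_top)
  have e : extChartAt 𝓘(𝕜, E) b =ᶠ[𝓝 x]
      (extChartAt 𝓘(𝕜, E) b ∘ (extChartAt 𝓘(𝕜, E) a).symm) ∘ extChartAt 𝓘(𝕜, E) a := by
    filter_upwards [extChartAt_source_mem_nhds' ha] with z hz
    simp only [Function.comp_apply, (extChartAt 𝓘(𝕜, E) a).left_inv hz]
  have ha' : MDifferentiableAt 𝓘(𝕜, E) 𝓘(𝕜, E) (extChartAt 𝓘(𝕜, E) a) x :=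
    mdifferentiableAt_extChartAt (by rwa [← extChartAt_source 𝓘(𝕜, E)])
  have ht := ((contDiffAt_transition ha hb).differentiableAt (by simp)).mdifferentiableAt
  rw [chartDeriv, e.mfderiv_eq, mfderiv_comp x ht ha', mfderiv_eq_fderiv]
  rfl

theorem inChart_transition {a b x : M} {V : Opens M} (u : RoughField 𝕜 E V)
    (ha : x ∈ (extChartAt 𝓘(𝕜, E) a).source) (hb : x ∈ (extChartAt 𝓘(𝕜, E) b).source) :
    ∀ᶠ z in 𝓝 (extChartAt 𝓘(𝕜, E) a x),
      inChart b u ((extChartAt 𝓘(𝕜, E) b ∘ (extChartAt 𝓘(𝕜, E) a).symm) z)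
        = ExteriorAlgebra.map (fderiv 𝕜 (extChartAt 𝓘(𝕜, E) b ∘ (extChartAt 𝓘(𝕜, E) a).symm)
            z).toLinearMap (inChart a u z) := by
  filter_upwards [eventually_mem_target ha, eventually_symm_mem_of_mem_source
    (V := ⟨_, isOpen_extChartAt_source (I := 𝓘(𝕜, E)) b⟩) hb ha] with z hz hz'
  have hza := (extChartAt 𝓘(𝕜, E) a).map_target hz
  obtain ⟨p, hp, rfl⟩ : ∃ p ∈ (extChartAt 𝓘(𝕜, E) a).source, extChartAt 𝓘(𝕜, E) a p = z :=
    ⟨_, hza, (extChartAt 𝓘(𝕜, E) a).right_inv hz⟩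
  rw [(extChartAt 𝓘(𝕜, E) a).left_inv hp] at hz'
  have hpb : p ∈ (extChartAt 𝓘(𝕜, E) b).source := hz'
  rw [Function.comp_apply, (extChartAt 𝓘(𝕜, E) a).left_inv hp, inChart_apply u hpb,
    inChart_apply u hp, chartDeriv_eq_comp hp hpb, ← AlgHom.comp_apply,
    ExteriorAlgebra.map_comp_map]
  rfl

/-- `IsSmoothField` tests each point in its own preferred chart. Near `x` the expression in the
chart at `b` is the one at `a`, transported by the smooth transition map and its derivative. -/
theorem smoothAt_inChart_of_smoothAt {a b x : M} {V : Opens M} {u : RoughField 𝕜 E V}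
    (ha : x ∈ (extChartAt 𝓘(𝕜, E) a).source) (hb : x ∈ (extChartAt 𝓘(𝕜, E) b).source)
    (h : SmoothAt (inChart a u) (extChartAt 𝓘(𝕜, E) a x)) :
    SmoothAt (inChart b u) (extChartAt 𝓘(𝕜, E) b x) := by
  rw [smoothAt_iff] at h ⊢
  set σ := extChartAt 𝓘(𝕜, E) a ∘ (extChartAt 𝓘(𝕜, E) b).symm
  set τ := extChartAt 𝓘(𝕜, E) b ∘ (extChartAt 𝓘(𝕜, E) a).symm
  have hσ : ContDiffAt 𝕜 ∞ σ (extChartAt 𝓘(𝕜, E) b x) := contDiffAt_transition hb ha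
  have eσ : σ (extChartAt 𝓘(𝕜, E) b x) = extChartAt 𝓘(𝕜, E) a x := by
    simp only [σ, Function.comp_apply, (extChartAt 𝓘(𝕜, E) b).left_inv hb]
  have hτ : ContDiffAt 𝕜 ∞ τ (σ (extChartAt 𝓘(𝕜, E) b x)) := by
    rw [eσ]; exact contDiffAt_transition ha hb
  have hc := hσ.continuousAt.eventually (by rw [eσ]; exact inChart_transition u ha hb)
  have key : inChart b u =ᶠ[𝓝 (extChartAt 𝓘(𝕜, E) b x)]
      fun z => ExteriorAlgebra.map (fderiv 𝕜 τ (σ z)).toLinearMap (inChart a u (σ z)) := by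
    filter_upwards [hc, eventually_mem_target hb, eventually_symm_mem_of_mem_source
      (V := ⟨_, isOpen_extChartAt_source (I := 𝓘(𝕜, E)) a⟩) ha hb] with z hz hzb hza
    rw [← hz]
    congr 1
    have hza' : (extChartAt 𝓘(𝕜, E) b).symm z ∈ (extChartAt 𝓘(𝕜, E) a).source := hza
    simp only [σ, Function.comp_apply, (extChartAt 𝓘(𝕜, E) a).left_inv hza',
      (extChartAt 𝓘(𝕜, E) b).right_inv hzb]
  refine ContDiffAt.congr_of_eventuallyEq ?_ key
  refine ContDiffAt.exteriorMap ((hτ.fderiv_right (m := ∞) (by simp)).comp _ hσ) ?_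
  exact ContDiffAt.comp _ (by rw [eσ]; exact h) hσ

theorem IsSmoothField.smoothAt_inChart {V : Opens M} {u : RoughField 𝕜 E V} (hu : IsSmoothField u)
    {b x : M} (hx : x ∈ V) (hb : x ∈ (extChartAt 𝓘(𝕜, E) b).source) :
    SmoothAt (inChart b u) (extChartAt 𝓘(𝕜, E) b x) :=
  smoothAt_inChart_of_smoothAt (mem_extChartAt_source x) hb (hu ⟨x, hx⟩)

/-- The chart used by `schouten` varies with the point. Invariance allows one fixed chart to serve
over its whole domain, which is needed before differentiating anything there. -/
theorem inChart_schouten {V : Opens M} {u v : RoughField 𝕜 E V} (hu : IsSmoothField u)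
    (hv : IsSmoothField v) {b x : M} (hx : x ∈ V) (hb : x ∈ (extChartAt 𝓘(𝕜, E) b).source) :
    inChart b (schouten u v) (extChartAt 𝓘(𝕜, E) b x)
      = flatSchouten (inChart b u) (inChart b v) (extChartAt 𝓘(𝕜, E) b x) := by
  have hxx := mem_extChartAt_source (I := 𝓘(𝕜, E)) x
  have e : (extChartAt 𝓘(𝕜, E) b ∘ (extChartAt 𝓘(𝕜, E) x).symm) (extChartAt 𝓘(𝕜, E) x x)
      = extChartAt 𝓘(𝕜, E) b x := by
    rw [Function.comp_apply, (extChartAt 𝓘(𝕜, E) x).left_inv hxx]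
  have h := flatSchouten_map (contDiffAt_transition hxx hb) (hu ⟨x, hx⟩) (hv ⟨x, hx⟩)
    (by rw [e]; exact hu.smoothAt_inChart hx hb) (by rw [e]; exact hv.smoothAt_inChart hx hb)
    (inChart_transition u hxx hb) (inChart_transition v hxx hb)
  rw [e] at h
  rw [h, inChart_apply _ hb, extendZero_of_mem _ hx, schouten, chartDeriv_eq_comp hxx hb]
  have := map_chartDeriv_inverse hxx (flatSchouten (inChart x u) (inChart x v)
    (extChartAt 𝓘(𝕜, E) x x))
  conv_rhs => rw [← this]
  rw [← AlgHom.comp_apply (ExteriorAlgebra.map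
    (fderiv 𝕜 (extChartAt 𝓘(𝕜, E) b ∘ (extChartAt 𝓘(𝕜, E) x).symm) _).toLinearMap),
    ExteriorAlgebra.map_comp_map]
  rfl

theorem roughField_ext {b : M} {V : Opens M} (hV : (V : Set M) ⊆ (extChartAt 𝓘(𝕜, E) b).source)
    {u v : RoughField 𝕜 E V}
    (h : ∀ x ∈ V, inChart b u (extChartAt 𝓘(𝕜, E) b x) = inChart b v (extChartAt 𝓘(𝕜, E) b x)) :
    u = v := by
  funext x
  have := h x x.2
  rw [inChart_apply _ (hV x.2), inChart_apply _ (hV x.2), extendZero_of_mem _ x.2,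
    extendZero_of_mem _ x.2] at this
  exact map_chartDeriv_injective (hV x.2) this

/-- The section of `⋀ TM` over `V` with the expression `g` in the preferred chart at `b`. -/
def ofChart (b : M) (V : Opens M) (g : E → ExteriorAlgebra 𝕜 E) : RoughField 𝕜 E V := fun x =>
  ExteriorAlgebra.map (chartDeriv (𝕜 := 𝕜) (E := E) b (x : M)).inverse.toLinearMap
    (g (extChartAt 𝓘(𝕜, E) b x))

theorem inChart_ofChart_apply {b : M} {V : Opens M} (g : E → ExteriorAlgebra 𝕜 E) {x : M}
    (hx : x ∈ V) (hb : x ∈ (extChartAt 𝓘(𝕜, E) b).source) :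
    inChart b (ofChart b V g) (extChartAt 𝓘(𝕜, E) b x) = g (extChartAt 𝓘(𝕜, E) b x) := by
  rw [inChart_apply _ hb, extendZero_of_mem _ hx, ofChart, map_chartDeriv_inverse hb]

theorem eventually_of_chart {b x : M} {V : Opens M} {P : E → Prop} (hx : x ∈ V)
    (hb : x ∈ (extChartAt 𝓘(𝕜, E) b).source)
    (h : ∀ y ∈ V, y ∈ (extChartAt 𝓘(𝕜, E) b).source → P (extChartAt 𝓘(𝕜, E) b y)) :
    ∀ᶠ z in 𝓝 (extChartAt 𝓘(𝕜, E) b x), P z := by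
  filter_upwards [eventually_symm_mem_of_mem_source hx hb, eventually_mem_target hb] with z hz hz'
  have := h _ hz ((extChartAt 𝓘(𝕜, E) b).map_target hz')
  rwa [(extChartAt 𝓘(𝕜, E) b).right_inv hz'] at this

theorem inChart_ofChart {b : M} {V : Opens M} (g : E → ExteriorAlgebra 𝕜 E) {x : M}
    (hx : x ∈ V) (hb : x ∈ (extChartAt 𝓘(𝕜, E) b).source) :
    inChart b (ofChart b V g) =ᶠ[𝓝 (extChartAt 𝓘(𝕜, E) b x)] g :=
  eventually_of_chart hx hb fun _ hy hyb => inChart_ofChart_apply g hy hyb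

theorem isSmoothField_ofChart {b : M} {V : Opens M}
    (hV : (V : Set M) ⊆ (extChartAt 𝓘(𝕜, E) b).source) {g : E → ExteriorAlgebra 𝕜 E}
    (hg : ∀ x ∈ V, SmoothAt g (extChartAt 𝓘(𝕜, E) b x)) : IsSmoothField (ofChart b V g) :=
  fun x => smoothAt_inChart_of_smoothAt (hV x.2) (mem_extChartAt_source (x : M))
    ((hg x x.2).congr (inChart_ofChart g x.2 (hV x.2)))

theorem hasDegree_of_inChart {b : M} {V : Opens M}
    (hV : (V : Set M) ⊆ (extChartAt 𝓘(𝕜, E) b).source) {p : ℕ} {u : Multivector 𝕜 E V}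
    (h : ∀ x ∈ V, inChart b u.1 (extChartAt 𝓘(𝕜, E) b x) ∈ ⋀[𝕜]^p E) : HasDegree p u := by
  intro x
  have := h x x.2
  rw [inChart_apply _ (hV x.2), extendZero_of_mem _ x.2] at this
  rw [← map_inverse_chartDeriv (hV x.2) (u.1 x)]
  exact map_mem_exteriorPower _ this

end Charts

/-! ### The Koszul operator of a chart -/

section ChartKoszul

variable {𝕜 : Type} [RCLike 𝕜] {E : Type} [NormedAddCommGroup E] [NormedSpace 𝕜 E]
  [FiniteDimensional 𝕜 E] {M : Type u} [TopologicalSpace M] [ChartedSpace E M]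

theorem inChart_sub (b : M) {V : Opens M} (u v : RoughField 𝕜 E V) :
    inChart b (u - v) = inChart b u - inChart b v := by
  have h : u - v = u + (-1 : 𝕜) • v := by rw [neg_one_smul, sub_eq_add_neg]
  rw [h, inChart_add, inChart_smul, neg_one_smul, sub_eq_add_neg]

theorem inChart_zero (b : M) (V : Opens M) : inChart b (0 : RoughField 𝕜 E V) = 0 := by
  have h := inChart_smul b (0 : 𝕜) (0 : RoughField 𝕜 E V)
  rwa [zero_smul, zero_smul] at h

variable (𝕜 E) in
/-- The domain of the preferred chart at `b`. -/
def chartDomain (b : M) : Opens M :=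
  ⟨(extChartAt 𝓘(𝕜, E) b).source, isOpen_extChartAt_source b⟩

variable [IsManifold 𝓘(𝕜, E) ∞ M]

/-- The operator `-∑ i(dx^i) ∂_i` in the coordinates of the preferred chart at `b`. -/
def chartDivergence (b : M) (V : Opens M) (hV : V ≤ chartDomain 𝕜 E b) :
    Multivector 𝕜 E V →ₗ[𝕜] Multivector 𝕜 E V where
  toFun u := ⟨ofChart b V (flatDivergence (inChart b u.1)),
    isSmoothField_ofChart hV fun _ hx => (u.2.smoothAt_inChart hx (hV hx)).flatDivergence⟩
  map_add' u v := by
    refine Subtype.ext (funext fun x => ?_)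
    change ofChart b V (flatDivergence (inChart b (u.1 + v.1))) x
      = ofChart b V (flatDivergence (inChart b u.1)) x
        + ofChart b V (flatDivergence (inChart b v.1)) x
    simp only [ofChart]
    rw [inChart_add, flatDivergence_add (u.2.smoothAt_inChart x.2 (hV x.2))
      (v.2.smoothAt_inChart x.2 (hV x.2)), map_add]
  map_smul' c u := by
    refine Subtype.ext (funext fun x => ?_)
    change ofChart b V (flatDivergence (inChart b (c • u.1))) x
      = c • ofChart b V (flatDivergence (inChart b u.1)) x
    simp only [ofChart]
    rw [inChart_smul, flatDivergence_smul (u.2.smoothAt_inChart x.2 (hV x.2)), map_smul]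

/-- Equality of germs, not only of values, because the operator is applied a second time for `D² =
0`. -/
theorem inChart_chartDivergence {b : M} {V : Opens M} (hV : V ≤ chartDomain 𝕜 E b)
    (u : Multivector 𝕜 E V) {x : M} (hx : x ∈ V) :
    inChart b (chartDivergence b V hV u).1 =ᶠ[𝓝 (extChartAt 𝓘(𝕜, E) b x)]
      flatDivergence (inChart b u.1) :=
  inChart_ofChart _ hx (hV hx)

theorem schouten_eq_chartDivergence {b : M} {V : Opens M} (hV : V ≤ chartDomain 𝕜 E b) {p : ℕ}
    {u : Multivector 𝕜 E V} (v : Multivector 𝕜 E V) (hu : HasDegree p u) :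
    schouten u.1 v.1 = ((-1 : 𝕜) ^ p • (chartDivergence b V hV (u * v)
      - chartDivergence b V hV u * v - (-1 : 𝕜) ^ p • (u * chartDivergence b V hV v)) :
        Multivector 𝕜 E V).1 := by
  refine roughField_ext hV fun x hx => ?_
  rw [inChart_schouten u.2 v.2 hx (hV hx), flatDivergence_generates
    (u.2.smoothAt_inChart hx (hV hx)) (v.2.smoothAt_inChart hx (hV hx))
    (Filter.Eventually.of_forall (inChart_mem_exteriorPower b hu))]
  change _ = inChart b ((-1 : 𝕜) ^ p • ((chartDivergence b V hV (u * v)).1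
      - (chartDivergence b V hV u).1 * v.1 - (-1 : 𝕜) ^ p • (u.1 * (chartDivergence b V hV v).1))) _
  simp only [inChart_smul, inChart_sub, inChart_mul, Pi.smul_apply, Pi.sub_apply, Pi.mul_apply,
    (inChart_chartDivergence hV _ hx).eq_of_nhds]
  rw [show (u * v).1 = u.1 * v.1 from rfl, inChart_mul]

/-- The Koszul operator of a chart, associated with the coordinate volume form. -/
def chartKoszulOperator (b : M) : KoszulOperator 𝕜 E (chartDomain 𝕜 E b) where
  op V hV := chartDivergence b V hV
  op_res V W hV hW u := by
    refine Subtype.ext (funext fun x => ?_)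
    change ofChart b W (flatDivergence (inChart b (roughRes hW u.1))) x
      = ofChart b V (flatDivergence (inChart b u.1)) ⟨x, hW x.2⟩
    simp only [ofChart]
    rw [flatDivergence_congr (inChart_roughRes_of_mem_source hW u.1 x.2 (hV (hW x.2)))]
  op_degree_zero V hV u hu := by
    refine Subtype.ext (funext fun x => ?_)
    change ofChart b V (flatDivergence (inChart b u.1)) x = 0
    simp only [ofChart]
    rw [flatDivergence_mem_zero (u.2.smoothAt_inChart x.2 (hV x.2))
      (Filter.Eventually.of_forall (inChart_mem_exteriorPower b hu)), map_zero]
  op_degree_succ V hV p u hu := hasDegree_of_inChart hV fun x hx => by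
    rw [(inChart_chartDivergence hV u hx).eq_of_nhds]
    exact flatDivergence_mem (u.2.smoothAt_inChart hx (hV hx))
      (Filter.Eventually.of_forall (inChart_mem_exteriorPower b hu))
  generates V hV p q u v hu _ := schouten_eq_chartDivergence hV v hu

theorem chartKoszulOperator_squareZero (b : M) :
    (chartKoszulOperator (𝕜 := 𝕜) (E := E) b).SquareZero := by
  intro V hV u
  refine Subtype.ext (funext fun x => ?_)
  change ofChart b V (flatDivergence (inChart b (chartDivergence b V hV u).1)) x = 0
  simp only [ofChart]
  rw [flatDivergence_congr (inChart_chartDivergence hV u x.2),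
    flatDivergence_flatDivergence (u.2.smoothAt_inChart x.2 (hV x.2)), map_zero]

end ChartKoszul

/-! ### The vector field `Dπ` is Poisson -/

section Modular

variable {𝕜 : Type} [RCLike 𝕜] {E : Type} [NormedAddCommGroup E] [NormedSpace 𝕜 E]
  [FiniteDimensional 𝕜 E] {M : Type u} [TopologicalSpace M] [ChartedSpace E M]

theorem PoissonTensor.hasDegree_on (π : PoissonTensor 𝕜 E M) (V : Opens M) :
    HasDegree 2 (π.on V) := fun x => π.hasDegree ⟨x, trivial⟩

theorem PoissonTensor.schouten_on (π : PoissonTensor 𝕜 E M) (V : Opens M) :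
    schouten (π.on V).1 (π.on V).1 = 0 := by
  have h := schouten_roughRes (le_top : V ≤ ⊤) π.tensor.1 π.tensor.1
  rw [π.schouten_self] at h
  exact h

theorem mul_comm_of_hasDegree_one_two {V : Opens M} {X P : Multivector 𝕜 E V}
    (hX : HasDegree 1 X) (hP : HasDegree 2 P) : P * X = X * P := by
  refine Subtype.ext (funext fun x => ?_)
  obtain ⟨w, hw⟩ := exists_ι_of_mem_one (hX x)
  have h := ι_mul_eq_involute_mul w (P.1 x)
  rw [involute_of_mem (hP x), hw] at h
  simpa using h.symm

theorem mul_self_of_hasDegree_one {V : Opens M} {X : Multivector 𝕜 E V} (hX : HasDegree 1 X) :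
    X * X = 0 := by
  refine Subtype.ext (funext fun x => ?_)
  obtain ⟨w, hw⟩ := exists_ι_of_mem_one (hX x)
  change X.1 x * X.1 x = 0
  rw [← hw, ExteriorAlgebra.ι_sq_zero]

theorem mul_comm_of_hasDegree_zero {V : Opens M} {f : Multivector 𝕜 E V}
    (hf : HasDegree 0 f) (u : Multivector 𝕜 E V) : u * f = f * u := by
  refine Subtype.ext (funext fun x => ?_)
  obtain ⟨c, hc⟩ := exists_algebraMap_of_mem_zero (hf x)
  change u.1 x * f.1 x = f.1 x * u.1 x
  rw [← hc, Algebra.commutes]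

theorem KoszulOperator.isPoisson_op {U : Opens M} (D : KoszulOperator 𝕜 E U) (hD : D.SquareZero)
    (π : PoissonTensor 𝕜 E M) : IsPoisson π (D.op U le_rfl (π.on U)) := by
  set P := π.on U
  have hP : HasDegree 2 P := π.hasDegree_on U
  set X := D.op U le_rfl P with hX
  have dX : HasDegree 1 X := D.op_degree_succ U le_rfl 1 P hP
  have h1 := D.generates U le_rfl 2 2 P P hP hP
  rw [π.schouten_on] at h1
  -- The two products coincide because a bivector commutes with a vector.
  have h2 : D.op U le_rfl (P * P) = (2 : 𝕜) • (X * P) := by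
    have h3 : (-1 : 𝕜) ^ 2 • (D.op U le_rfl (P * P) - X * P - (-1 : 𝕜) ^ 2 • (P * X)) = 0 :=
      Subtype.ext h1.symm
    rw [neg_one_sq, one_smul, one_smul, mul_comm_of_hasDegree_one_two dX hP, sub_sub,
      sub_eq_zero] at h3
    rw [h3, two_smul]
  -- `D²(π ∧ π) = 0`, divided by two.
  have h4 : D.op U le_rfl (X * P) = 0 := by
    have h5 := hD U le_rfl (P * P)
    rw [h2, map_smul] at h5
    exact (smul_eq_zero.1 h5).resolve_left two_ne_zero
  refine ⟨dX, ?_⟩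
  rw [D.generates U le_rfl 1 2 X P dX hP, h4, ← hX, mul_self_of_hasDegree_one dX, hX, hD]
  simp

/-! ### Koszul operators of square zero have local potentials -/

variable [IsManifold 𝓘(𝕜, E) ∞ M]

/-- The coordinate vector field `∂_i` of the preferred chart at `b`. -/
def coordField (b : M) {V : Opens M} (hV : V ≤ chartDomain 𝕜 E b)
    (i : Fin (Module.finrank 𝕜 E)) : Multivector 𝕜 E V :=
  ⟨ofChart b V fun _ => ExteriorAlgebra.ι 𝕜 (frame 𝕜 E i),
    isSmoothField_ofChart hV fun _ _ => smoothAt_const _ _⟩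

theorem inChart_coordField {b : M} {V : Opens M} (hV : V ≤ chartDomain 𝕜 E b)
    (i : Fin (Module.finrank 𝕜 E)) {x : M} (hx : x ∈ V) :
    inChart b (coordField b hV i).1 =ᶠ[𝓝 (extChartAt 𝓘(𝕜, E) b x)]
      fun _ => ExteriorAlgebra.ι 𝕜 (frame 𝕜 E i) :=
  inChart_ofChart (fun _ => ExteriorAlgebra.ι 𝕜 (frame 𝕜 E i)) hx (hV hx)

theorem hasDegree_coordField {b : M} {V : Opens M} (hV : V ≤ chartDomain 𝕜 E b)
    (i : Fin (Module.finrank 𝕜 E)) : HasDegree 1 (coordField b hV i) :=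
  hasDegree_of_inChart hV fun x hx => by
    rw [(inChart_coordField hV i hx).eq_of_nhds]
    exact ι_mem_exteriorPower_one _

theorem partialDeriv_const (a : ExteriorAlgebra 𝕜 E) (i : Fin (Module.finrank 𝕜 E)) (y : E) :
    partialDeriv i (fun _ => a) y = 0 := by
  rw [partialDeriv_eq_fderiv (differentiableAt_const a)]; simp

/-- A coordinate field has constant components, so only the half of the bracket that differentiates
`u` survives. -/
theorem inChart_schouten_coordField {b : M} {V : Opens M} (hV : V ≤ chartDomain 𝕜 E b)
    (u : Multivector 𝕜 E V) (i : Fin (Module.finrank 𝕜 E)) {x : M} (hx : x ∈ V) :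
    inChart b (schouten u.1 (coordField b hV i).1) (extChartAt 𝓘(𝕜, E) b x)
      = -partialDeriv i (inChart b u.1) (extChartAt 𝓘(𝕜, E) b x) := by
  rw [inChart_schouten u.2 (coordField b hV i).2 hx (hV hx),
    flatSchouten_congr (Filter.EventuallyEq.refl _ _) (inChart_coordField hV i hx)]
  simp [flatSchouten, partialDeriv_const, Finsupp.single_apply, apply_ite]

theorem schouten_coordField {b : M} {V : Opens M} (hV : V ≤ chartDomain 𝕜 E b)
    (i j : Fin (Module.finrank 𝕜 E)) :
    schouten (coordField b hV i).1 (coordField b hV j).1 = 0 :=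
  roughField_ext hV fun x hx => by
    rw [inChart_schouten_coordField hV _ j hx, partialDeriv_congr (inChart_coordField hV i hx),
      partialDeriv_const, neg_zero]
    rw [inChart_zero, Pi.zero_apply]

/-- Closedness of the coefficient form. Put `f_i = D(∂_i)`. Since coordinate fields commute, `D(∂_i
∧ ∂_j) = f_i ∂_j - f_j ∂_i`, and `D² = 0` gives `D(f_i ∂_j) = D(f_j ∂_i)`. As `D f_i = 0`, the
bracket `{f_i, ∂_j}` equals `D(f_i ∂_j) - f_i f_j`, now symmetric in `i` and `j`. -/
theorem KoszulOperator.schouten_op_coordField {U : Opens M} (D : KoszulOperator 𝕜 E U)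
    (hD : D.SquareZero) {b : M} {V : Opens M} (hU : V ≤ U) (hV : V ≤ chartDomain 𝕜 E b)
    (i j : Fin (Module.finrank 𝕜 E)) :
    schouten (D.op V hU (coordField b hV i)).1 (coordField b hV j).1
      = schouten (D.op V hU (coordField b hV j)).1 (coordField b hV i).1 := by
  set X := coordField (𝕜 := 𝕜) (E := E) b hV with hX
  have dX : ∀ i, HasDegree 1 (X i) := hasDegree_coordField hV
  have df : ∀ i, HasDegree 0 (D.op V hU (X i)) := fun i => D.op_degree_succ V hU 0 _ (dX i)
  have h1 : ∀ i j, schouten (D.op V hU (X i)).1 (X j).1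
      = (D.op V hU (D.op V hU (X i) * X j) - D.op V hU (X i) * D.op V hU (X j)).1 := by
    intro i j
    rw [D.generates V hU 0 1 _ _ (df i) (dX j), hD, zero_mul, sub_zero, pow_zero, one_smul,
      one_smul]
  have h2 : ∀ i j, D.op V hU (X i * X j)
      = D.op V hU (X i) * X j - D.op V hU (X j) * X i := by
    intro i j
    have h3 := D.generates V hU 1 1 _ _ (dX i) (dX j)
    rw [schouten_coordField hV] at h3
    have h4 : (-1 : 𝕜) ^ 1 • (D.op V hU (X i * X j) - D.op V hU (X i) * X j
        - (-1 : 𝕜) ^ 1 • (X i * D.op V hU (X j))) = 0 := Subtype.ext h3.symm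
    rw [pow_one, neg_one_smul, neg_one_smul, neg_eq_zero, sub_neg_eq_add,
      mul_comm_of_hasDegree_zero (df j)] at h4
    rw [eq_sub_iff_add_eq, ← sub_eq_zero, ← h4]
    abel
  have h5 : D.op V hU (D.op V hU (X i) * X j) = D.op V hU (D.op V hU (X j) * X i) := by
    have h6 := hD V hU (X i * X j)
    rwa [h2, map_sub, sub_eq_zero] at h6
  rw [h1, h1, h5, mul_comm_of_hasDegree_zero (df i)]

/-- The coefficient functions of `D` in the preferred chart at `b`. -/
def KoszulOperator.coeff {U : Opens M} (D : KoszulOperator 𝕜 E U) (b : M) {V : Opens M}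
    (hU : V ≤ U) (hV : V ≤ chartDomain 𝕜 E b) (i : Fin (Module.finrank 𝕜 E)) (y : E) : 𝕜 :=
  ExteriorAlgebra.algebraMapInv (inChart b (D.op V hU (coordField b hV i)).1 y)

theorem KoszulOperator.algebraMap_coeff {U : Opens M} (D : KoszulOperator 𝕜 E U) {b : M}
    {V : Opens M} (hU : V ≤ U) (hV : V ≤ chartDomain 𝕜 E b) (i : Fin (Module.finrank 𝕜 E))
    (y : E) : algebraMap 𝕜 _ (D.coeff b hU hV i y)
      = inChart b (D.op V hU (coordField b hV i)).1 y :=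
  algebraMap_algebraMapInv (inChart_mem_exteriorPower b
    (D.op_degree_succ V hU 0 _ (hasDegree_coordField hV i)) y)

theorem KoszulOperator.contDiffAt_coeff {U : Opens M} (D : KoszulOperator 𝕜 E U) {b : M}
    {V : Opens M} (hU : V ≤ U) (hV : V ≤ chartDomain 𝕜 E b) (i : Fin (Module.finrank 𝕜 E))
    {x : M} (hx : x ∈ V) :
    ContDiffAt 𝕜 ∞ (D.coeff b hU hV i) (extChartAt 𝓘(𝕜, E) b x) :=
  (smoothAt_iff.1 ((D.op V hU (coordField b hV i)).2.smoothAt_inChart hx (hV hx))).linearMap_comp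
    (ExteriorAlgebra.algebraMapInv (R := 𝕜) (M := E)).toLinearMap

theorem KoszulOperator.fderiv_coeff_symm {U : Opens M} (D : KoszulOperator 𝕜 E U)
    (hD : D.SquareZero) {b : M} {V : Opens M} (hU : V ≤ U) (hV : V ≤ chartDomain 𝕜 E b)
    (i j : Fin (Module.finrank 𝕜 E)) {x : M} (hx : x ∈ V) :
    fderiv 𝕜 (D.coeff b hU hV i) (extChartAt 𝓘(𝕜, E) b x) (frame 𝕜 E j)
      = fderiv 𝕜 (D.coeff b hU hV j) (extChartAt 𝓘(𝕜, E) b x) (frame 𝕜 E i) := by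
  have hd : ∀ i, DifferentiableAt 𝕜 (inChart b (D.op V hU (coordField b hV i)).1)
      (extChartAt 𝓘(𝕜, E) b x) := fun i => (smoothAt_iff.1
    ((D.op V hU (coordField b hV i)).2.smoothAt_inChart hx (hV hx))).differentiableAt (by simp)
  have e : ∀ i w, fderiv 𝕜 (D.coeff b hU hV i) (extChartAt 𝓘(𝕜, E) b x) w
      = ExteriorAlgebra.algebraMapInv (fderiv 𝕜 (inChart b (D.op V hU (coordField b hV i)).1)
        (extChartAt 𝓘(𝕜, E) b x) w) := fun i w =>
    fderiv_linearMap_comp (ExteriorAlgebra.algebraMapInv (R := 𝕜) (M := E)).toLinearMap (hd i) w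
  have h := congrArg (fun s => inChart b s (extChartAt 𝓘(𝕜, E) b x))
    (D.schouten_op_coordField hD hU hV i j)
  simp only [inChart_schouten_coordField hV _ _ hx, partialDeriv_eq_fderiv (hd _), neg_inj] at h
  rw [e, e, h]

/-- The Poincaré lemma for `1`-forms on a ball. -/
theorem exists_primitive_on_ball {η : E → E →L[𝕜] 𝕜} {c : E} {r : ℝ}
    (hη : ∀ y ∈ Metric.ball c r, ContDiffAt 𝕜 ∞ η y)
    (hs : ∀ y ∈ Metric.ball c r, ∀ v w, fderiv 𝕜 η y v w = fderiv 𝕜 η y w v) :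
    ∃ h : E → 𝕜, ContDiffOn 𝕜 ∞ h (Metric.ball c r) ∧
      ∀ y ∈ Metric.ball c r, HasFDerivAt h (η y) y := by
  -- Convexity is a real notion, so the symmetric derivative is restricted to `ℝ`. The form itself
  -- stays `𝕜`-linear, and its primitive is `𝕜`-differentiable, hence holomorphic in the complex
  -- case.
  let : NormedSpace ℝ E := .restrictScalars ℝ 𝕜 E
  obtain ⟨h, hh⟩ := (convex_ball c r).exists_forall_hasFDerivWithinAt_of_hasFDerivWithinAt_symmetric
    (dω := fun y => (fderiv 𝕜 η y).restrictScalars ℝ)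
    (fun y hy => (((hη y hy).differentiableAt (by simp)).hasFDerivAt.restrictScalars
      ℝ).hasFDerivWithinAt) (fun y hy v _ w _ => hs y hy v w)
  have hh' : ∀ y ∈ Metric.ball c r, HasFDerivAt h (η y) y := fun y hy =>
    (hh y hy).hasFDerivAt (Metric.isOpen_ball.mem_nhds hy)
  refine ⟨h, ?_, hh'⟩
  rw [contDiffOn_infty_iff_fderiv_of_isOpen Metric.isOpen_ball]
  exact ⟨fun y hy => (hh' y hy).differentiableAt.differentiableWithinAt,
    ContDiffOn.congr (fun y hy => (hη y hy).contDiffWithinAt) fun y hy => (hh' y hy).fderiv⟩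

/-- The `1`-form `∑ c_i dx^i`. -/
def oneForm (c : Fin (Module.finrank 𝕜 E) → E → 𝕜) (y : E) : E →L[𝕜] 𝕜 :=
  ∑ i, c i y • ((frame 𝕜 E).coord i).toContinuousLinearMap

theorem oneForm_frame (c : Fin (Module.finrank 𝕜 E) → E → 𝕜) (y : E)
    (i : Fin (Module.finrank 𝕜 E)) : oneForm c y (frame 𝕜 E i) = c i y := by
  simp [oneForm, Finsupp.single_apply]

theorem fderiv_oneForm_symm {c : Fin (Module.finrank 𝕜 E) → E → 𝕜} {y : E}
    (hc : ∀ i, DifferentiableAt 𝕜 (c i) y)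
    (hs : ∀ i j, fderiv 𝕜 (c i) y (frame 𝕜 E j) = fderiv 𝕜 (c j) y (frame 𝕜 E i)) (v w : E) :
    fderiv 𝕜 (oneForm c) y v w = fderiv 𝕜 (oneForm c) y w v := by
  have hd : HasFDerivAt (oneForm c) (∑ i, (fderiv 𝕜 (c i) y).smulRight
      ((frame 𝕜 E).coord i).toContinuousLinearMap) y :=
    HasFDerivAt.fun_sum fun i _ => (hc i).hasFDerivAt.smul_const
      ((frame 𝕜 E).coord i).toContinuousLinearMap
  have e : ∀ v w, fderiv 𝕜 (oneForm c) y v w = ∑ i, ∑ j, (frame 𝕜 E).coord j v *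
      (frame 𝕜 E).coord i w * fderiv 𝕜 (c i) y (frame 𝕜 E j) := by
    intro v w
    rw [hd.fderiv, sum_apply, sum_apply]
    refine Finset.sum_congr rfl fun i _ => ?_
    have hv : fderiv 𝕜 (c i) y v
        = ∑ j, (frame 𝕜 E).coord j v * fderiv 𝕜 (c i) y (frame 𝕜 E j) := by
      conv_lhs => rw [← (frame 𝕜 E).sum_repr v, map_sum]
      simp
    change fderiv 𝕜 (c i) y v * (frame 𝕜 E).coord i w = _
    rw [hv, Finset.sum_mul]
    exact Finset.sum_congr rfl fun j _ => mul_right_comm _ _ _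
  rw [e, e, Finset.sum_comm]
  refine Finset.sum_congr rfl fun i _ => Finset.sum_congr rfl fun j _ => ?_
  rw [hs, mul_comm ((frame 𝕜 E).coord i v)]

theorem KoszulOperator.exists_potential {U : Opens M} (D : KoszulOperator 𝕜 E U)
    (hD : D.SquareZero) {b : M} {V : Opens M} (hU : V ≤ U) (hV : V ≤ chartDomain 𝕜 E b)
    {c : E} {r : ℝ} (hr : ∀ y ∈ Metric.ball c r, ∃ x ∈ V, extChartAt 𝓘(𝕜, E) b x = y) :
    ∃ h : E → 𝕜, ContDiffOn 𝕜 ∞ h (Metric.ball c r) ∧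
      ∀ y ∈ Metric.ball c r, HasFDerivAt h (oneForm (D.coeff b hU hV) y) y := by
  refine exists_primitive_on_ball (fun y hy => ?_) (fun y hy => ?_)
  · obtain ⟨x, hx, rfl⟩ := hr y hy
    exact ContDiffAt.sum fun i _ => (D.contDiffAt_coeff hU hV i hx).smul contDiffAt_const
  · obtain ⟨x, hx, rfl⟩ := hr y hy
    exact fderiv_oneForm_symm
      (fun i => (D.contDiffAt_coeff hU hV i hx).differentiableAt (by simp))
      (fun i j => D.fderiv_coeff_symm hD hU hV i j hx)

end Modular

/-! ### Comparison of two Koszul operators of square zero -/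

section Comparison

variable {𝕜 : Type} [RCLike 𝕜] {E : Type} [NormedAddCommGroup E] [NormedSpace 𝕜 E]
  [FiniteDimensional 𝕜 E] {M : Type u} [TopologicalSpace M] [ChartedSpace E M]

/-- The value at `y` of the expression of a multivector field in the preferred chart at `b`. -/
def evalChart (b : M) (V : Opens M) (y : E) : Multivector 𝕜 E V →ₗ[𝕜] ExteriorAlgebra 𝕜 E where
  toFun u := inChart b u.1 y
  map_add' u v := congrFun (inChart_add b u.1 v.1) y
  map_smul' c u := congrFun (inChart_smul b c u.1) y

theorem evalChart_mul (b : M) (V : Opens M) (y : E) (u v : Multivector 𝕜 E V) :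
    evalChart b V y (u * v) = evalChart b V y u * evalChart b V y v :=
  congrFun (inChart_mul b u.1 v.1) y

/-- Both operators generate the same bracket, so it drops out of the difference, leaving an
antiderivation. -/
theorem KoszulOperator.op_sub_op_mul {U U' V : Opens M} (D : KoszulOperator 𝕜 E U)
    (D' : KoszulOperator 𝕜 E U') (hU : V ≤ U) (hU' : V ≤ U') {q : ℕ} {X u : Multivector 𝕜 E V}
    (hX : HasDegree 1 X) (hu : HasDegree q u) :
    D.op V hU (X * u) - D'.op V hU' (X * u)
      = (D.op V hU X - D'.op V hU' X) * u - X * (D.op V hU u - D'.op V hU' u) := by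
  have h : (-1 : 𝕜) ^ 1 • (D.op V hU (X * u) - D.op V hU X * u
      - (-1 : 𝕜) ^ 1 • (X * D.op V hU u))
      = (-1 : 𝕜) ^ 1 • (D'.op V hU' (X * u) - D'.op V hU' X * u
      - (-1 : 𝕜) ^ 1 • (X * D'.op V hU' u)) :=
    Subtype.ext ((D.generates V hU 1 q X u hX hu).symm.trans (D'.generates V hU' 1 q X u hX hu))
  rw [pow_one, neg_one_smul, neg_one_smul, neg_one_smul, neg_one_smul, neg_inj, sub_neg_eq_add,
    sub_neg_eq_add] at h
  rw [sub_mul, mul_sub]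
  have h' := sub_eq_zero.2 h
  rw [← sub_eq_zero, ← h']
  abel

variable [IsManifold 𝓘(𝕜, E) ∞ M]

theorem evalChart_coordField {b : M} {V : Opens M} (hV : V ≤ chartDomain 𝕜 E b)
    (i : Fin (Module.finrank 𝕜 E)) {x : M} (hx : x ∈ V) :
    evalChart b V (extChartAt 𝓘(𝕜, E) b x) (coordField b hV i)
      = ExteriorAlgebra.ι 𝕜 (frame 𝕜 E i) :=
  (inChart_coordField hV i hx).eq_of_nhds

/-- The interior product `i(dx^i)u` of a multivector field with a coordinate differential of the
preferred chart at `b`. -/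
def coordInterior (b : M) {V : Opens M} (hV : V ≤ chartDomain 𝕜 E b)
    (i : Fin (Module.finrank 𝕜 E)) (u : Multivector 𝕜 E V) : Multivector 𝕜 E V :=
  ⟨ofChart b V fun y => interiorProduct ((frame 𝕜 E).coord i) (inChart b u.1 y),
    isSmoothField_ofChart hV fun _ hx => smoothAt_iff.2
      ((smoothAt_iff.1 (u.2.smoothAt_inChart hx (hV hx))).linearMap_comp _)⟩

theorem evalChart_coordInterior {b : M} {V : Opens M} (hV : V ≤ chartDomain 𝕜 E b)
    (i : Fin (Module.finrank 𝕜 E)) (u : Multivector 𝕜 E V) {x : M} (hx : x ∈ V) :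
    evalChart b V (extChartAt 𝓘(𝕜, E) b x) (coordInterior b hV i u)
      = interiorProduct ((frame 𝕜 E).coord i) (evalChart b V (extChartAt 𝓘(𝕜, E) b x) u) :=
  inChart_ofChart_apply
    (fun y => interiorProduct ((frame 𝕜 E).coord i) (inChart b u.1 y)) hx (hV hx)

theorem hasDegree_coordInterior {b : M} {V : Opens M} (hV : V ≤ chartDomain 𝕜 E b)
    (i : Fin (Module.finrank 𝕜 E)) {p : ℕ} {u : Multivector 𝕜 E V} (hu : HasDegree (p + 1) u) :
    HasDegree p (coordInterior b hV i u) :=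
  hasDegree_of_inChart hV fun x hx => by
    have h := evalChart_coordInterior hV i u hx
    change evalChart b V _ _ ∈ _
    rw [h]
    exact interiorProduct_mem_of_mem_succ _ (inChart_mem_exteriorPower b hu _)

theorem sum_coordField_mul_coordInterior {b : M} {V : Opens M} (hV : V ≤ chartDomain 𝕜 E b)
    {p : ℕ} {u : Multivector 𝕜 E V} (hu : HasDegree p u) :
    ∑ i, coordField b hV i * coordInterior b hV i u = (p : 𝕜) • u := by
  refine Subtype.ext (roughField_ext hV fun x hx => ?_)
  change evalChart b V _ _ = evalChart b V _ _
  simp only [map_sum, evalChart_mul, evalChart_coordField hV _ hx,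
    evalChart_coordInterior hV _ _ hx, map_smul]
  exact sum_ι_mul_interiorProduct _ (inChart_mem_exteriorPower b hu _)

/-- Induction on the degree. Euler's formula writes a multiple of `u` as `∑ ∂_i ∧ i(dx^i)u`, with
factors that are sections over all of `V`; the antiderivation rule then reduces to `∂_i` and to
lower degree. In degree zero both sides vanish. -/
theorem KoszulOperator.evalChart_op_sub_op {U U' V : Opens M} (D : KoszulOperator 𝕜 E U)
    (D' : KoszulOperator 𝕜 E U') (hU : V ≤ U) (hU' : V ≤ U') {b : M}
    (hV : V ≤ chartDomain 𝕜 E b) {x : M} (hx : x ∈ V) (p : ℕ) (u : Multivector 𝕜 E V)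
    (hu : HasDegree p u) :
    evalChart b V (extChartAt 𝓘(𝕜, E) b x) (D.op V hU u - D'.op V hU' u)
      = interiorProduct (oneForm (D.coeff b hU hV) (extChartAt 𝓘(𝕜, E) b x)
          - oneForm (D'.coeff b hU' hV) (extChartAt 𝓘(𝕜, E) b x)).toLinearMap
        (evalChart b V (extChartAt 𝓘(𝕜, E) b x) u) := by
  set y := extChartAt 𝓘(𝕜, E) b x
  set α := (oneForm (D.coeff b hU hV) y - oneForm (D'.coeff b hU' hV) y).toLinearMap with hα
  induction p generalizing u with
  | zero =>
    rw [D.op_degree_zero V hU u hu, D'.op_degree_zero V hU' u hu, sub_zero, map_zero]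
    exact (interiorProduct_of_mem_zero α (inChart_mem_exteriorPower b hu y)).symm
  | succ p ih =>
    have hc : ∀ i, evalChart b V y (D.op V hU (coordField b hV i) - D'.op V hU' (coordField b hV i))
        = algebraMap 𝕜 _ (α (frame 𝕜 E i)) := by
      intro i
      rw [map_sub, hα, ContinuousLinearMap.coe_coe, sub_apply, oneForm_frame, oneForm_frame,
        map_sub, D.algebraMap_coeff, D'.algebraMap_coeff]
      rfl
    have key : ∀ i, evalChart b V y (D.op V hU (coordField b hV i * coordInterior b hV i u)
        - D'.op V hU' (coordField b hV i * coordInterior b hV i u))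
        = interiorProduct α (evalChart b V y (coordField b hV i * coordInterior b hV i u)) := by
      intro i
      rw [D.op_sub_op_mul D' hU hU' (hasDegree_coordField hV i) (hasDegree_coordInterior hV i hu),
        map_sub, evalChart_mul, evalChart_mul, evalChart_mul, hc,
        ih _ (hasDegree_coordInterior hV i hu), evalChart_coordField hV i hx,
        interiorProduct_ι_mul, Algebra.smul_def]
    -- Summing over `i` yields the claim multiplied by `p + 1`, which is invertible in `𝕜`.
    have h := Finset.sum_congr (rfl : (Finset.univ : Finset (Fin (Module.finrank 𝕜 E))) = _)
      fun i _ => key i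
    simp only [← map_sum] at h
    rw [Finset.sum_sub_distrib, ← map_sum, ← map_sum, sum_coordField_mul_coordInterior hV hu,
      map_smul, map_smul, ← smul_sub, map_smul, map_smul, map_smul] at h
    exact smul_right_injective _ (Nat.cast_ne_zero.2 p.succ_ne_zero) h

theorem exists_chart_ball {U : Opens M} {b : M} (hb : b ∈ U) :
    ∃ r > 0, ∀ y ∈ Metric.ball (extChartAt 𝓘(𝕜, E) b b) r,
      y ∈ (extChartAt 𝓘(𝕜, E) b).target ∧ (extChartAt 𝓘(𝕜, E) b).symm y ∈ U :=
  Metric.eventually_nhds_iff_ball.1 ((eventually_mem_target (mem_extChartAt_source b)).and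
    (eventually_symm_mem b hb))

theorem differential_comp_extChartAt {b x : M} (hx : x ∈ (extChartAt 𝓘(𝕜, E) b).source)
    {g : E → 𝕜} {η : E →L[𝕜] 𝕜} (hg : HasFDerivAt g η (extChartAt 𝓘(𝕜, E) b x)) :
    differential (𝕜 := 𝕜) (E := E) (g ∘ extChartAt 𝓘(𝕜, E) b) x
      = η.toLinearMap ∘ₗ (chartDeriv b x).toLinearMap := by
  have : IsManifold 𝓘(𝕜, E) 1 M := IsManifold.of_le (n := ∞) (by exact_mod_cast le_top)
  have hch : MDifferentiableAt 𝓘(𝕜, E) 𝓘(𝕜, E) (extChartAt 𝓘(𝕜, E) b) x :=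
    mdifferentiableAt_extChartAt (by rwa [← extChartAt_source 𝓘(𝕜, E)])
  rw [differential, mfderiv_comp x hg.differentiableAt.mdifferentiableAt hch, mfderiv_eq_fderiv,
    hg.fderiv]
  rfl

/-- Two Koszul operators of square zero define the same class modulo locally hamiltonian vector
fields. -/
theorem KoszulOperator.derRes_sub_derRes_mem_ham {U U' : Opens M} (D : KoszulOperator 𝕜 E U)
    (D' : KoszulOperator 𝕜 E U') (hD : D.SquareZero) (hD' : D'.SquareZero)
    (π : PoissonTensor 𝕜 E M) {W : Opens M} (hU : W ≤ U) (hU' : W ≤ U') :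
    derRes π hU ⟨D.op U le_rfl (π.on U), D.isPoisson_op hD π⟩
      - derRes π hU' ⟨D'.op U' le_rfl (π.on U'), D'.isPoisson_op hD' π⟩ ∈ Ham π W := by
  intro b hb
  obtain ⟨r, hr, hball⟩ := exists_chart_ball (𝕜 := 𝕜) (E := E) hb
  -- A coordinate ball inside `W`: the chart maps it onto the whole ball, as the Poincaré lemma
  -- requires.
  let V : Opens M := ⟨(extChartAt 𝓘(𝕜, E) b).source ∩
    extChartAt 𝓘(𝕜, E) b ⁻¹' Metric.ball (extChartAt 𝓘(𝕜, E) b b) r,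
    isOpen_extChartAt_preimage' b Metric.isOpen_ball⟩
  have hV : V ≤ chartDomain 𝕜 E b := fun x hx => hx.1
  have hVW : V ≤ W := fun x hx => by
    have h := (hball _ hx.2).2
    rwa [(extChartAt 𝓘(𝕜, E) b).left_inv hx.1] at h
  have hsurj : ∀ y ∈ Metric.ball (extChartAt 𝓘(𝕜, E) b b) r, ∃ x ∈ V,
      extChartAt 𝓘(𝕜, E) b x = y := fun y hy => by
    have ht := (hball y hy).1
    have e := (extChartAt 𝓘(𝕜, E) b).right_inv ht
    exact ⟨_, ⟨(extChartAt 𝓘(𝕜, E) b).map_target ht, by rwa [Set.mem_preimage, e]⟩, e⟩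
  obtain ⟨h, hh, dh⟩ := D.exists_potential hD (hVW.trans hU) hV hsurj
  obtain ⟨h', hh', dh'⟩ := D'.exists_potential hD' (hVW.trans hU') hV hsurj
  -- The Hamiltonian is the difference of the two potentials, pulled back by the chart.
  refine ⟨V, hVW, (h - h') ∘ extChartAt 𝓘(𝕜, E) b,
    ⟨mem_extChartAt_source b, Metric.mem_ball_self hr⟩, ?_, fun x => ?_⟩
  · refine (hh.sub hh').contMDiffOn.comp (t := Metric.ball (extChartAt 𝓘(𝕜, E) b b) r)
      (contMDiffOn_extChartAt.mono ?_) fun x hx => hx.2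
    rw [← extChartAt_source 𝓘(𝕜, E)]
    exact fun x hx => hx.1
  · have hx := x.2
    have hcmp := D.evalChart_op_sub_op D' (hVW.trans hU) (hVW.trans hU') hV hx 2 (π.on V)
      (π.hasDegree_on V)
    have hd := differential_comp_extChartAt hx.1 ((dh _ hx.2).sub (dh' _ hx.2))
    have e1 := congrArg Subtype.val (D.op_res U V le_rfl (hVW.trans hU) (π.on U))
    have e2 := congrArg Subtype.val (D'.op_res U' V le_rfl (hVW.trans hU') (π.on U'))
    have e3 : (D.op V (hVW.trans hU) (π.on V) - D'.op V (hVW.trans hU') (π.on V)).1 x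
        = (D.op U le_rfl (π.on U)).1 ⟨x, hU (hVW hx)⟩
          - (D'.op U' le_rfl (π.on U')).1 ⟨x, hU' (hVW hx)⟩ :=
      congrArg₂ (· - ·) (congrFun e1 x) (congrFun e2 x)
    change (D.op U le_rfl (π.on U)).1 ⟨x, hU (hVW hx)⟩
      - (D'.op U' le_rfl (π.on U')).1 ⟨x, hU' (hVW hx)⟩ = _
    rw [← e3]
    -- Both sides are compared after the chart derivative, where the difference of the operators is
    -- known to be an interior product.
    refine map_chartDeriv_injective (hV hx) ?_
    rw [hd, ← interiorProduct_map]
    change inChart b _ _ = interiorProduct _ (inChart b _ _) at hcmp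
    rwa [inChart_apply _ (hV hx), inChart_apply _ (hV hx), extendZero_of_mem _ hx,
      extendZero_of_mem _ hx] at hcmp

end Comparison

/-! ### Gluing in the quotient sheaf -/

section Gluing

open CategoryTheory Opposite

variable {𝕜 : Type} [RCLike 𝕜] {E : Type} [NormedAddCommGroup E] [NormedSpace 𝕜 E]
  [FiniteDimensional 𝕜 E] {M : Type u} [TopologicalSpace M] [ChartedSpace E M]
  {π : PoissonTensor 𝕜 E M}

theorem OuterField.res_outerClass {U V : Opens M} (h : V ≤ U) (ξ : Der π U) :
    (outerClass ξ).res h = outerClass (derRes π h ξ) := by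
  have e := ConcreteCategory.congr_hom
    ((toSheafify (Opens.grothendieckTopology M) (outerPresheaf π)).naturality (homOfLE h).op)
    (QuotientAddGroup.mk ξ : Der π U ⧸ Ham π U)
  exact e.symm

theorem outerClass_eq_of_sub_mem {V : Opens M} {ξ η : Der π V} (h : ξ - η ∈ Ham π V) :
    outerClass ξ = outerClass η := by
  have e : (QuotientAddGroup.mk ξ : Der π V ⧸ Ham π V) = QuotientAddGroup.mk η :=
    QuotientAddGroup.eq_iff_sub_mem.2 h
  rw [outerClass, e, outerClass]

/-- Compatible sections of `Der/Ham` over an open cover of `M` glue uniquely. -/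
theorem OuterField.existsUnique_gluing {κ : Type*} (U : κ → Opens M) (hU : ⊤ ≤ iSup U)
    (s : ∀ i, OuterField π (U i))
    (hs : ∀ i j, (s i).res (inf_le_left : U i ⊓ U j ≤ U i) = (s j).res inf_le_right) :
    ∃! ξ : OuterField π ⊤, ∀ i, ξ.res (le_top : U i ≤ ⊤) = s i :=
  TopCat.Sheaf.existsUnique_gluing' (X := TopCat.of M) (outerSheaf π) U ⊤
    (fun _ => homOfLE le_top) hU s hs

end Gluing

end PoissonGeometry

end

/-! ### The canonical outer vector field -/

theorem theorem2 {𝕜 : Type} [RCLike 𝕜] {E : Type} [NormedAddCommGroup E] [NormedSpace 𝕜 E]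
    [FiniteDimensional 𝕜 E] {M : Type*} [TopologicalSpace M] [ChartedSpace E M]
    [IsManifold 𝓘(𝕜, E) ∞ M] (π : PoissonGeometry.PoissonTensor 𝕜 E M) :
    (∀ x : M, ∃ U : Opens M, x ∈ U ∧
      ∃ D : PoissonGeometry.KoszulOperator 𝕜 E U, D.SquareZero) ∧
    ∃! ξ : PoissonGeometry.OuterField π ⊤,
      ∀ (U : Opens M) (D : PoissonGeometry.KoszulOperator 𝕜 E U), D.SquareZero →
        ∃ h : D.op U le_rfl (π.on U) ∈ PoissonGeometry.Der π U,
          ξ.res le_top = PoissonGeometry.outerClass ⟨D.op U le_rfl (π.on U), h⟩ := by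
  open PoissonGeometry in
  have local_existence : ∀ x : M, ∃ U : Opens M, x ∈ U ∧
      ∃ D : KoszulOperator 𝕜 E U, D.SquareZero := fun x =>
    ⟨chartDomain 𝕜 E x, mem_extChartAt_source x, chartKoszulOperator x,
      chartKoszulOperator_squareZero x⟩
  refine ⟨local_existence, ?_⟩
  -- The cover is indexed by all pairs of an open set and a square-zero Koszul operator on it, so
  -- the gluing condition is exactly the required property for every `D`, with no choice of
  -- operators.
  obtain ⟨ξ, hξ, huniq⟩ := OuterField.existsUnique_gluing (π := π)
    (κ := Σ U : Opens M, {D : KoszulOperator 𝕜 E U // D.SquareZero}) (fun i => i.1)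
    (fun x _ => by
      obtain ⟨U, hx, D, hD⟩ := local_existence x
      exact Opens.mem_iSup.2 ⟨⟨U, D, hD⟩, hx⟩)
    (fun i => outerClass ⟨i.2.1.op i.1 le_rfl (π.on i.1), i.2.1.isPoisson_op i.2.2 π⟩)
    (fun i j => by
      rw [OuterField.res_outerClass, OuterField.res_outerClass]
      exact outerClass_eq_of_sub_mem
        (i.2.1.derRes_sub_derRes_mem_ham j.2.1 i.2.2 j.2.2 π inf_le_left inf_le_right))
  refine ⟨ξ, fun U D hD => ⟨D.isPoisson_op hD π, hξ ⟨U, D, hD⟩⟩, fun ξ' hξ' => ?_⟩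
  exact huniq ξ' fun i => (hξ' i.1 i.2.1 i.2.2).2
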